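/- **Theorem (Langevin and O'Hara).** Let $S^n\subset\mathbb R^{n+1}$ be the unit sphere and let $\Delta$ denote the diagonal. For $x\in S^n$ let $p_x\colon S^n\setminus\{x\}\to x^{\perp}$, $p_x(y)=\frac{y-\langle x,y\rangle x}{1-\langle x,y\rangle}$, be the stereographic projection from $x$ onto the $n$-plane through the origin orthogonal to $x$. Identify $x^\perp$ with $T_xS^n$, and $T_xS^n$ with $T_x^*S^n$ by the Euclidean inner product. This gives a smooth bijection $$\varphi\colon S^n\times S^n\setminus\Delta\to T^*S^n,\qquad (x,y)\mapsto \bigl(x,\ \langle p_x(y),\,\cdot\,\rangle\bigr).$$ Let $\omega_{S^n}$ denote both the canonical symplectic form of $T^*S^n$, which is $\sum_i dq_i\wedge dp_i$ in local coordinates $q_i$ of $S^n$ and the fibre coordinates $p_i$ associated with the basis $\{dq_i\}$, and its pull-back by $\varphi$ to $S^n\times S^n\setminus\Delta$. A Möbius transformation of $S^n$ is the action of an element of the Lorentz group $O(n+1,1)$ on the set of lines in the light cone of $\mathbb R^{n+2}_1$, the point $x\in S^n$ being identified with the line spanned by $(1,x)$. 1. For every $n$ and every Möbius transformation $T$ of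 $S^n$ (which is smooth and preserves $S^n\times S^n\setminus\Delta$), $(T\times T)^*\omega_{S^n}=\omega_{S^n}$ on $S^n\times S^n\setminus\Delta$. 2. Let $\omega_{\rm cr}=\frac{dw\wedge dz}{(w-z)^2}$ on $\mathbb C\times\mathbb C\setminus\Delta$, and let $\sigma\colon\mathbb C\to S^2$ be the inverse of a stereographic projection of $S^2$ from one of its points onto the corresponding equatorial plane, identified isometrically with $\mathbb C$. Then $\operatorname{Re}\omega_{\rm cr}=-\tfrac12(\sigma\times\sigma)^*\omega_{S^2}$. 3. Let $2\le k\le\infty$ and let $K\subset S^3$ be a knot of class $C^k$, given by a regular $1$-periodic parametrization $\gamma\colon\mathbb R\to S^3$ of class $C^k$ that is injective modulo $\mathbb Z$. For $x=\gamma(s)\neq y=\gamma(t)$ choose a round $2$-sphere in $S^3$ that is tangent to $K$ at $x$ and at $y$, and identify it with $\mathbb C\cup\{\infty\}$ by a stereographic projection from a point other than $x,y$. Let $\tilde x,\tilde y\in\mathbb C$ be the images of $x,y$, let $a,b\in\mathbb C$ be the images of the tangent vectors $\gamma'(s),\gamma'(t)$, and orient the sphere so that $c(s,t)=\frac{ab}{(\tilde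 x-\tilde y)^2}$ has non-negative imaginary part. Then $c(s,t)$ exists and does not depend on the choices, so that the infinitesimal cross ratio $\Omega_K=\frac{d\tilde x\wedge d\tilde y}{(\tilde x-\tilde y)^2}=c(s,t)\,ds\wedge dt$ is a well-defined complex $2$-form on $K\times K\setminus\Delta$. With the inclusion $\iota\colon K\times K\setminus\Delta\hookrightarrow S^3\times S^3\setminus\Delta$, $$\operatorname{Re}\Omega_K=-\tfrac12\,\iota^*\omega_{S^3}.$$ In particular $\operatorname{Re}\Omega_K$ is exact: there is a $1$-form $\eta$ of class $C^{k-1}$ on $K\times K\setminus\Delta$ with $d\eta=\operatorname{Re}\Omega_K$. -/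

import Mathlib

open Set Metric
open scoped Manifold ContDiff Bundle

namespace MoebiusKnot

noncomputable section

/-! ### Two-forms -/

/-- The wedge product `α ∧ β` of two one-forms on a vector space, with
`(α ∧ β)(v, w) = α(v) β(w) - α(w) β(v)`. -/
def wedge {V A : Type*} [TopologicalSpace V] [AddCommGroup V] [Module ℝ V]
    [NormedCommRing A] [NormedAlgebra ℝ A] (α β : V →L[ℝ] A) : V [⋀^Fin 2]→L[ℝ] A where
  toFun v := α (v 0) * β (v 1) - α (v 1) * β (v 0)
  map_update_add' v i x y := by
    fin_cases i <;> simp [Function.update] <;> ring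
  map_update_smul' v i c x := by
    fin_cases i <;> simp [Function.update, smul_sub]
  map_eq_zero_of_eq' v i j h hij := by
    fin_cases i <;> fin_cases j <;> simp_all
  cont := by fun_prop

/-- The pull-back `f^* α` of a real two-form `α` by a map of manifolds. -/
def pullback {E H M E' H' M' : Type*}
    [NormedAddCommGroup E] [NormedSpace ℝ E] [TopologicalSpace H] (I : ModelWithCorners ℝ E H)
    [TopologicalSpace M] [ChartedSpace H M]
    [NormedAddCommGroup E'] [NormedSpace ℝ E'] [TopologicalSpace H']
    (I' : ModelWithCorners ℝ E' H') [TopologicalSpace M'] [ChartedSpace H' M']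
    (f : M → M') (α : ∀ q : M', TangentSpace I' q [⋀^Fin 2]→L[ℝ] ℝ) (p : M) :
    TangentSpace I p [⋀^Fin 2]→L[ℝ] ℝ :=
  (α (f p)).compContinuousLinearMap (mfderiv I I' f p)

/-! ### The cotangent bundle and its canonical symplectic form -/

/-- `ℝ^m` with its Euclidean norm. -/
abbrev Euc (m : ℕ) : Type := EuclideanSpace ℝ (Fin m)

/-- The total space of the cotangent bundle `T^* M` of an `m`-dimensional manifold `M`. -/
abbrev Cotangent (m : ℕ) (M : Type*) [TopologicalSpace M] [ChartedSpace (Euc m) M]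
    [IsManifold (𝓡 m) ∞ M] : Type _ :=
  Bundle.TotalSpace (Euc m →L[ℝ] ℝ) (fun x : M => TangentSpace (𝓡 m) x →L[ℝ] Bundle.Trivial M ℝ x)

/-- The model with corners of `T^* M`. -/
abbrev cotangentModel (m : ℕ) :
    ModelWithCorners ℝ (Euc m × (Euc m →L[ℝ] ℝ)) (ModelProd (Euc m) (Euc m →L[ℝ] ℝ)) :=
  (𝓡 m).prod 𝓘(ℝ, Euc m →L[ℝ] ℝ)

/-- The `i`-th base coordinate `q_i` on `ℝ^m × (ℝ^m)^*`. -/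
def qCoord {m : ℕ} (i : Fin m) : (Euc m × (Euc m →L[ℝ] ℝ)) →L[ℝ] ℝ :=
  (EuclideanSpace.proj i).comp (ContinuousLinearMap.fst ℝ _ _)

/-- The `i`-th fibre coordinate `p_i` on `ℝ^m × (ℝ^m)^*`, a covector being
`∑ i, p_i dq_i`. -/
def pCoord {m : ℕ} (i : Fin m) : (Euc m × (Euc m →L[ℝ] ℝ)) →L[ℝ] ℝ :=
  (ContinuousLinearMap.apply ℝ ℝ (EuclideanSpace.single i (1 : ℝ))).comp
    (ContinuousLinearMap.snd ℝ _ _)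

/-- The canonical symplectic form `∑ i, dq_i ∧ dp_i` of `T^* M`. At a covector `ξ` it is computed
in the bundle chart `(q_1, …, q_m, p_1, …, p_m)` of `T^* M` that is induced by the preferred chart
`(q_1, …, q_m)` of `M` at the base point of `ξ`. -/
def canonicalSymplecticForm (m : ℕ) (M : Type*) [TopologicalSpace M] [ChartedSpace (Euc m) M]
    [IsManifold (𝓡 m) ∞ M] (ξ : Cotangent m M) :
    TangentSpace (cotangentModel m) ξ [⋀^Fin 2]→L[ℝ] ℝ :=
  (∑ i : Fin m, wedge (qCoord i) (pCoord i)).compContinuousLinearMap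
    (mfderiv (cotangentModel m) 𝓘(ℝ, Euc m × (Euc m →L[ℝ] ℝ))
      (extChartAt (cotangentModel m) ξ) ξ)

/-! ### The identification of `S^n × S^n ∖ Δ` with `T^* S^n` -/

/-- The unit sphere `S^n` of `ℝ^(n+1)`. -/
abbrev Sph (n : ℕ) : Type := sphere (0 : Euc (n + 1)) 1

/-- The model with corners of `S^n × S^n`. -/
abbrev pairModel (n : ℕ) : ModelWithCorners ℝ (Euc n × Euc n) (ModelProd (Euc n) (Euc n)) :=
  (𝓡 n).prod (𝓡 n)

/-- The complement of the diagonal in `X × X`. -/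
def distinctPairs (X : Type*) : Set (X × X) := {p | p.1 ≠ p.2}

/-- The stereographic projection `p_x` of `S^n ∖ {x}` from `x` onto the `n`-plane through the
origin that is orthogonal to `x`. -/
def stereo {n : ℕ} (x y : Sph n) : Euc (n + 1) :=
  (1 - inner ℝ (x : Euc (n + 1)) y)⁻¹ •
    ((y : Euc (n + 1)) - inner ℝ (x : Euc (n + 1)) (y : Euc (n + 1)) • (x : Euc (n + 1)))

/-- The map `φ_x : S^n ∖ {x} → T_x^* S^n`, taking `y` to the covector `v ↦ ⟨p_x(y), v⟩`; here
`T_x S^n` is regarded as a subspace of `ℝ^(n+1)` through the derivative of the inclusion. -/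
def toCovector {n : ℕ} (x y : Sph n) : TangentSpace (𝓡 n) x →L[ℝ] ℝ :=
  (innerSL ℝ (stereo x y)).comp
    (mfderiv (𝓡 n) 𝓘(ℝ, Euc (n + 1)) (fun z : Sph n => (z : Euc (n + 1))) x)

/-- The map `φ : (x, y) ↦ (x, φ_x(y))` from `S^n × S^n ∖ Δ` to `T^* S^n`
(only its values off the diagonal matter). -/
def toCotangent (n : ℕ) (p : Sph n × Sph n) : Cotangent n (Sph n) :=
  ⟨p.1, toCovector p.1 p.2⟩

/-- The two-form `ω_{S^n}` on `S^n × S^n ∖ Δ`: the pull-back by `φ` of the canonical symplectic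
form of `T^* S^n`. -/
def omegaSphere (n : ℕ) (p : Sph n × Sph n) : TangentSpace (pairModel n) p [⋀^Fin 2]→L[ℝ] ℝ :=
  pullback (pairModel n) (cotangentModel n) (toCotangent n) (canonicalSymplecticForm n (Sph n)) p

/-! ### Moebius transformations -/

/-- The matrix `diag(-1, 1, …, 1)` of the Lorentz metric on `ℝ^(n+2)`. -/
def lorentzGram (n : ℕ) : Matrix (Fin (n + 2)) (Fin (n + 2)) ℝ :=
  Matrix.diagonal (Fin.cons (-1) (fun _ => 1))

/-- The lightlike vector `(1, x)` that represents the point `x` of `S^n`. -/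
def lightVec {n : ℕ} (x : Sph n) : Fin (n + 2) → ℝ := Fin.cons 1 (fun i => (x : Euc (n + 1)) i)

/-- `T` is a Moebius transformation of `S^n`: the action of an element of `O(n+1,1)` on the set of
lines in the light cone. -/
def IsMoebius {n : ℕ} (T : Sph n → Sph n) : Prop :=
  ∃ A : Matrix (Fin (n + 2)) (Fin (n + 2)) ℝ,
    A.transpose * lorentzGram n * A = lorentzGram n ∧
    ∀ x : Sph n, ∃ c : ℝ, c ≠ 0 ∧ A.mulVec (lightVec x) = c • lightVec (T x)

/-! ### The complex cross ratio form -/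

/-- The inverse of the stereographic projection, from the pole `q + ρ e₂`, of the two-sphere with
centre `q` and radius `ρ` in the affine three-space `q + span(e₀, e₁, e₂)` onto its equatorial
plane, which is identified with `ℂ` through the orthonormal frame `(e₀, e₁)`
and the scale `ρ`. -/
def invStereo {m : ℕ} (q : Euc m) (ρ : ℝ) (e : Fin 3 → Euc m) (ζ : ℂ) : Euc m :=
  q + (ρ / (‖ζ‖ ^ 2 + 1)) •
    ((2 * ζ.re) • e 0 + (2 * ζ.im) • e 1 + (‖ζ‖ ^ 2 - 1) • e 2)

/-- `σ : ℂ → S^2` is the inverse of a stereographic projection of `S^2`. -/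
def IsInvStereo (σ : ℂ → Sph 2) : Prop :=
  ∃ e : Fin 3 → Euc 3, Orthonormal ℝ e ∧ ∀ ζ, (σ ζ : Euc 3) = invStereo 0 1 e ζ

/-- The complex two-form `ω_cr = dw ∧ dz / (w - z)^2` on `ℂ × ℂ ∖ Δ`. -/
def crossRatioForm (p : ℂ × ℂ) : (ℂ × ℂ) [⋀^Fin 2]→L[ℝ] ℂ :=
  (1 / (p.1 - p.2) ^ 2) • wedge (ContinuousLinearMap.fst ℝ ℂ ℂ) (ContinuousLinearMap.snd ℝ ℂ ℂ)

/-- The real part of a complex-valued two-form. -/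
def rePart {V : Type*} [TopologicalSpace V] [AddCommGroup V] [Module ℝ V]
    (α : V [⋀^Fin 2]→L[ℝ] ℂ) : V [⋀^Fin 2]→L[ℝ] ℝ :=
  Complex.reCLM.compContinuousAlternatingMap α

/-! ### Knots in `S^3` and the infinitesimal cross ratio -/

/-- `γ` is a regular `1`-periodic parametrization, of class `C^k`, of a knot in `S^3`.
The knot `K` is then identified with `ℝ/ℤ`, and `K × K` with `(ℝ/ℤ)²`. -/
structure IsKnot (k : ℕ∞ω) (γ : ℝ → Sph 3) : Prop where
  contDiff : ContDiff ℝ k (fun t => (γ t : Euc 4))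
  immersion : ∀ t, deriv (fun s => (γ s : Euc 4)) t ≠ 0
  eq_iff : ∀ s t, γ s = γ t ↔ ∃ m : ℤ, t = s + m

/-- `c` is the value of `dx̃ dỹ / (x̃ - ỹ)²` on tangent vectors `u`, `v` of a knot at distinct points
`x`, `y` of `S^3`: there is a two-sphere in `S^3` through `x` and `y` to which `u` and `v` are
tangent, with an identification of it with `ℂ ∪ {∞}` by a stereographic projection under which
`x`, `y` correspond to `X`, `Y` and the tangent vectors `u`, `v` to `a`, `b`, such that
`c = a b / (X - Y)²`. The orientation of the sphere is the one for which the imaginary part of `c`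
is non-negative. -/
def IsInfinitesimalCrossRatio (x y u v : Euc 4) (c : ℂ) : Prop :=
  ∃ (q : Euc 4) (ρ : ℝ) (e : Fin 3 → Euc 4), 0 < ρ ∧ Orthonormal ℝ e ∧
    (∀ ζ, invStereo q ρ e ζ ∈ sphere (0 : Euc 4) 1) ∧
    ∃ X Y a b : ℂ,
      invStereo q ρ e X = x ∧ invStereo q ρ e Y = y ∧
      fderiv ℝ (invStereo q ρ e) X a = u ∧ fderiv ℝ (invStereo q ρ e) Y b = v ∧
      c = a * b / (X - Y) ^ 2 ∧ 0 ≤ c.im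

/-- The pairs of parameters of `K × K ∖ Δ`. -/
def knotPairs (γ : ℝ → Sph 3) : Set (ℝ × ℝ) := {p | γ p.1 ≠ γ p.2}

/-- `c` is the coefficient of `ds ∧ dt` in the infinitesimal cross ratio of the knot at
`(γ s, γ t)`. -/
def IsKnotCrossRatio (γ : ℝ → Sph 3) (p : ℝ × ℝ) (c : ℂ) : Prop :=
  IsInfinitesimalCrossRatio (γ p.1) (γ p.2)
    (deriv (fun s => (γ s : Euc 4)) p.1) (deriv (fun s => (γ s : Euc 4)) p.2) c

/-- The infinitesimal cross ratio `Ω_K`, a complex two-form on `K × K ∖ Δ`, in the parameters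
`(s, t)`. -/
def knotCrossRatio (γ : ℝ → Sph 3) (p : ℝ × ℝ) : (ℝ × ℝ) [⋀^Fin 2]→L[ℝ] ℂ :=
  Classical.epsilon (IsKnotCrossRatio γ p) •
    wedge (Complex.ofRealCLM.comp (ContinuousLinearMap.fst ℝ ℝ ℝ))
      (Complex.ofRealCLM.comp (ContinuousLinearMap.snd ℝ ℝ ℝ))

end

end MoebiusKnot

open MoebiusKnot

/-! Everything rests on one formula. At a pair of distinct points `(x, y)`, the form `ω_{S^n}` has
no `dx dx` and no `dy dy` part, and its mixed part is the bilinear form `mixedForm`, that is `B(u,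
v) = -∂_u ∂_v log (1 - ⟨x, y⟩)` with `u` acting on `x` and `v` on `y` (`omegaSphere_apply`). In a
bundle chart `φ` reads `(q, ⟨p_x(y), dι_q ·⟩)`, with `ι` the inclusion of the sphere. The second
derivative of `ι` drops out by symmetry, and so do the terms of the derivative of `p_x(y)` in the
direction of `x`.

A mixed second derivative of a logarithm does not change when its argument is multiplied by a
function of `x` alone and a function of `y` alone. Each part of the theorem uses this. (1) `1 - ⟨x,
y⟩` is minus the Lorentz product of `(1, x)` and `(1, y)`. A Lorentz map preserves this product, and
a Möbius map differs from it only by rescaling the light vectors (`lorentzMixedForm_rescale`,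
`mixedForm_moebius`). (2) `1 - ⟨x, y⟩` is half of `|x - y|²`, which under inverse stereographic
projection becomes `|X - Y|²` times one-variable factors. Since `log |X - Y|² = 2 Re log (X - Y)`,
it follows that `B = -2 Re (a b / (X - Y)²)` (`chordForm_invStereo`, `mixedForm_invStereo`). This
holds on any round two-sphere contained in a unit sphere. (3) Hence `Re c = -B/2` for every
admissible sphere. By conformality `|c| = |u| |v| / |x - y|²`, so the sign condition on `Im c` fixes
`c`. Existence comes from a hyperplane section of `S^3` containing both tangent lines. A primitive
of the real part is `-½ d_s log (1 - ⟨γ(s), γ(t)⟩)`, which involves only one derivative of `γ`. -/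

open Filter Topology
open scoped RealInnerProductSpace

/-! ### The sphere and its cotangent bundle in charts. -/

/-- The inclusion of the sphere in the coordinates of the preferred chart at `x₀`. -/
noncomputable def chartInclusion {n : ℕ} (x₀ : Sph n) (e : Euc n) : Euc (n + 1) :=
  ((extChartAt (𝓡 n) x₀).symm e : Sph n)

/-- The charts of the sphere are stereographic projections, hence onto; so `chartInclusion` is
smooth on the whole model space and plain `fderiv` can be used. -/
theorem extChartAt_sphere_target {n : ℕ} (x₀ : Sph n) : (extChartAt (𝓡 n) x₀).target = univ := by
  rw [extChartAt_target]
  simp [chartAt, ChartedSpace.chartAt]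

theorem contMDiff_coe_sph {n : ℕ} {m : ℕ∞ω} :
    ContMDiff (𝓡 n) 𝓘(ℝ, Euc (n + 1)) m (fun z : Sph n => (z : Euc (n + 1))) :=
  have : Fact (Module.finrank ℝ (Euc (n + 1)) = n + 1) := ⟨finrank_euclideanSpace_fin⟩
  contMDiff_coe_sphere

theorem contDiff_chartInclusion {n : ℕ} (x₀ : Sph n) : ContDiff ℝ ∞ (chartInclusion x₀) := by
  rw [← contMDiff_iff_contDiff, ← contMDiffOn_univ, ← extChartAt_sphere_target x₀]
  exact contMDiff_coe_sph.comp_contMDiffOn (contMDiffOn_extChartAt_symm x₀)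

/-- The differential of the inclusion of the sphere. -/
noncomputable def dincl {n : ℕ} (x : Sph n) : TangentSpace (𝓡 n) x →L[ℝ] Euc (n + 1) :=
  mfderiv (𝓡 n) 𝓘(ℝ, Euc (n + 1)) (fun z : Sph n => (z : Euc (n + 1))) x

/-- Covectors are represented by ambient vectors `w`; in the bundle chart such a covector becomes
`w` paired with the derivative of the inclusion written in coordinates, by the chain rule. -/
theorem trivializationAt_cotangent_snd {n : ℕ} {x₀ x : Sph n}
    (hx : x ∈ (chartAt (Euc n) x₀).source) (w : Euc (n + 1)) :
    (trivializationAt (Euc n →L[ℝ] ℝ)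
      (fun x : Sph n => TangentSpace (𝓡 n) x →L[ℝ] Bundle.Trivial (Sph n) ℝ x) x₀
      ⟨x, (innerSL ℝ w).comp (dincl x)⟩).2 =
    (innerSL ℝ w).comp (fderiv ℝ (chartInclusion x₀) (extChartAt (𝓡 n) x₀ x)) := by
  rw [hom_trivializationAt_apply]
  simp only [ContinuousLinearMap.inCoordinates]
  rw [TangentBundle.symmL_trivializationAt hx]
  have h : fderiv ℝ (chartInclusion x₀) (extChartAt (𝓡 n) x₀ x) =
      (dincl x).comp (mfderivWithin 𝓘(ℝ, Euc n) (𝓡 n) (extChartAt (𝓡 n) x₀).symm (range (𝓡 n))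
        (extChartAt (𝓡 n) x₀ x)) := by
    have h1 : MDifferentiableAt (𝓡 n) 𝓘(ℝ, Euc (n + 1)) (fun z : Sph n => (z : Euc (n + 1)))
      ((extChartAt (𝓡 n) x₀).symm (extChartAt (𝓡 n) x₀ x)) :=
      (contMDiff_coe_sph (m := 1)).mdifferentiableAt one_ne_zero
    have h2 : MDifferentiableWithinAt 𝓘(ℝ, Euc n) (𝓡 n) (extChartAt (𝓡 n) x₀).symm (range (𝓡 n))
        (extChartAt (𝓡 n) x₀ x) :=
      mdifferentiableWithinAt_extChartAt_symm ((extChartAt (𝓡 n) x₀).map_source (by simpa using hx))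
    have h3 := mfderiv_comp_mfderivWithin (extChartAt (𝓡 n) x₀ x) h1 h2 (by simp [uniqueMDiffWithinAt_univ])
    rw [(extChartAt (𝓡 n) x₀).left_inv (by simpa using hx)] at h3
    refine Eq.trans ?_ h3
    rw [← mfderiv_eq_fderiv]
    simp only [modelWithCornersSelf_coe, range_id, mfderivWithin_univ]
    rfl
  rw [h]
  ext e
  exact DFunLike.congr_fun (Bundle.Trivial.continuousLinearMapAt_trivialization ℝ (Sph n) ℝ x) _

theorem inner_self_sph {n : ℕ} (x : Sph n) : ⟪(x : Euc (n + 1)), x⟫ = 1 := by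
  rw [real_inner_self_eq_norm_sq, norm_eq_of_mem_sphere, one_pow]

theorem one_sub_inner_pos {n : ℕ} {x y : Sph n} (h : x ≠ y) :
    0 < 1 - ⟪(x : Euc (n + 1)), y⟫ := by
  have := inner_lt_one_iff_real_of_norm_eq_one (norm_eq_of_mem_sphere x) (norm_eq_of_mem_sphere y)
  have h' : (x : Euc (n + 1)) ≠ y := fun h' => h (Subtype.ext h')
  linarith [this.2 h']

theorem inner_dincl_self {n : ℕ} (x : Sph n) (u : TangentSpace (𝓡 n) x) :
    ⟪(x : Euc (n + 1)), dincl x u⟫ = 0 := by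
  have : Fact (Module.finrank ℝ (Euc (n + 1)) = n + 1) := ⟨finrank_euclideanSpace_fin⟩
  have h := range_mvfderiv_subtypeVal (n := n) x
  have h1 : dincl x u ∈ (Submodule.span ℝ {(x : Euc (n + 1))})ᗮ := by
    rw [← h]
    exact ⟨u, rfl⟩
  exact Submodule.mem_orthogonal_singleton_iff_inner_right.1 h1

theorem exists_dincl_eq {n : ℕ} (x : Sph n) {v : Euc (n + 1)} (hv : ⟪(x : Euc (n + 1)), v⟫ = 0) :
    ∃ u, dincl x u = v := by
  have : Fact (Module.finrank ℝ (Euc (n + 1)) = n + 1) := ⟨finrank_euclideanSpace_fin⟩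
  have h := range_mvfderiv_subtypeVal (n := n) x
  have h1 : v ∈ (Submodule.span ℝ {(x : Euc (n + 1))})ᗮ :=
    Submodule.mem_orthogonal_singleton_iff_inner_right.2 hv
  rw [← h] at h1
  exact h1

theorem dincl_injective {n : ℕ} (x : Sph n) : Function.Injective (dincl x) := by
  have : Fact (Module.finrank ℝ (Euc (n + 1)) = n + 1) := ⟨finrank_euclideanSpace_fin⟩
  exact injective_mvfderiv_subtypeVal_sphere x

/-! ### The derivative of stereographic projection, and `φ` in bundle charts. -/

/-- The stereographic projection from `p.1`, as a map on pairs of vectors. -/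
noncomputable def stereoAmbient {m : ℕ} (p : Euc m × Euc m) : Euc m :=
  (1 - ⟪p.1, p.2⟫)⁻¹ • (p.2 - ⟪p.1, p.2⟫ • p.1)

theorem contDiffAt_stereoAmbient {m : ℕ} {p : Euc m × Euc m} (h : 1 - ⟪p.1, p.2⟫ ≠ 0) :
    ContDiffAt ℝ ∞ stereoAmbient p := by
  unfold stereoAmbient
  have h1 : ContDiffAt ℝ ∞ (fun p : Euc m × Euc m => ⟪p.1, p.2⟫) p :=
    contDiffAt_fst.inner ℝ contDiffAt_snd
  exact ((contDiffAt_const.sub h1).inv h).smul (contDiffAt_snd.sub (h1.smul contDiffAt_fst))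

/-- Pairing with `w` orthogonal to `p.1` removes the terms along `p.1`, and tangential vectors are
all that `ω_{S^n}` sees. -/
theorem inner_fderiv_stereoAmbient {m : ℕ} {p : Euc m × Euc m} (h : 1 - ⟪p.1, p.2⟫ ≠ 0)
    (u v w : Euc m) (hw : ⟪p.1, w⟫ = 0) :
    ⟪fderiv ℝ stereoAmbient p (u, v), w⟫ =
      (⟪v, w⟫ - ⟪p.1, p.2⟫ * ⟪u, w⟫) / (1 - ⟪p.1, p.2⟫)
        + (⟪u, p.2⟫ + ⟪p.1, v⟫) * ⟪p.2, w⟫ / (1 - ⟪p.1, p.2⟫) ^ 2 := by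
  have h1 : HasFDerivAt (fun p : Euc m × Euc m => ⟪p.1, p.2⟫) _ p :=
    hasFDerivAt_fst.inner ℝ hasFDerivAt_snd
  have h2 := ((hasDerivAt_inv h).comp_hasFDerivAt p (h1.const_sub 1)).smul (hasFDerivAt_snd.sub (h1.smul hasFDerivAt_fst))
  have h3 : fderiv ℝ stereoAmbient p = _ := h2.fderiv
  rw [h3]
  simp [inner_add_left, inner_sub_left, inner_smul_left, hw]
  field_simp
  ring

/-- The mixed part of the symplectic form `ω_{S^n}` at `(x, y)`. -/
noncomputable def mixedForm {m : ℕ} (x y u v : Euc m) : ℝ :=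
  ⟪u, v⟫ / (1 - ⟪x, y⟫) + ⟪u, y⟫ * ⟪x, v⟫ / (1 - ⟪x, y⟫) ^ 2

/-- The map `φ` in the bundle chart of the cotangent bundle over the preferred chart at `x₀`. -/
noncomputable def toCotangentChart {n : ℕ} (x₀ : Sph n) (p : Sph n × Sph n) :
    Euc n × (Euc n →L[ℝ] ℝ) :=
  (extChartAt (𝓡 n) x₀ p.1,
    (innerSL ℝ (stereo p.1 p.2)).comp (fderiv ℝ (chartInclusion x₀) (extChartAt (𝓡 n) x₀ p.1)))

theorem eventually_fst_mem_chart_source {n : ℕ} (p : Sph n × Sph n) :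
    ∀ᶠ p' in 𝓝 p, p'.1 ∈ (chartAt (Euc n) p.1).source :=
  continuousAt_fst.eventually_mem (chart_source_mem_nhds (Euc n) p.1)

theorem contMDiffAt_stereo {n : ℕ} {p : Sph n × Sph n} (hp : p ∈ distinctPairs (Sph n)) :
    ContMDiffAt (pairModel n) 𝓘(ℝ, Euc (n + 1)) ∞ (fun p : Sph n × Sph n => stereo p.1 p.2) p := by
  have h1 : ContMDiffAt (pairModel n) 𝓘(ℝ, Euc (n + 1) × Euc (n + 1)) ∞
      (fun p : Sph n × Sph n => ((p.1 : Euc (n + 1)), (p.2 : Euc (n + 1)))) p :=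
    (contMDiff_coe_sph.comp contMDiff_fst).contMDiffAt.prodMk_space
      (contMDiff_coe_sph.comp contMDiff_snd).contMDiffAt
  have h2 : ContMDiffAt 𝓘(ℝ, Euc (n + 1) × Euc (n + 1)) 𝓘(ℝ, Euc (n + 1)) ∞ stereoAmbient
      ((p.1 : Euc (n + 1)), (p.2 : Euc (n + 1))) :=
    (contDiffAt_stereoAmbient (one_sub_inner_pos hp).ne').contMDiffAt
  have h3 : (fun p : Sph n × Sph n => stereo p.1 p.2) = stereoAmbient ∘
    (fun p : Sph n × Sph n => ((p.1 : Euc (n + 1)), (p.2 : Euc (n + 1)))) := rfl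
  rw [h3]
  exact ContMDiffAt.comp (f := fun p : Sph n × Sph n =>
    ((p.1 : Euc (n + 1)), (p.2 : Euc (n + 1)))) p h2 h1

theorem contMDiffAt_toCotangentChart {n : ℕ} {p : Sph n × Sph n}
    (hp : p ∈ distinctPairs (Sph n)) :
    ContMDiffAt (pairModel n) 𝓘(ℝ, Euc n × (Euc n →L[ℝ] ℝ)) ∞ (toCotangentChart p.1) p := by
  have h1 : ContMDiffAt (pairModel n) 𝓘(ℝ, Euc n) ∞
      (fun p' : Sph n × Sph n => extChartAt (𝓡 n) p.1 p'.1) p :=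
    ContMDiffAt.comp p contMDiffAt_extChartAt contMDiffAt_fst
  have h2 : ContDiff ℝ ∞ (fderiv ℝ (chartInclusion p.1)) :=
    (contDiff_chartInclusion p.1).fderiv_right (by simp)
  refine h1.prodMk_space (ContMDiffAt.clm_comp ?_ (h2.contMDiff.contMDiffAt.comp p h1))
  exact (innerSL ℝ).contDiff.contMDiff.contMDiffAt.comp p (contMDiffAt_stereo hp)

theorem contMDiffAt_toCotangent {n : ℕ} {p : Sph n × Sph n} (hp : p ∈ distinctPairs (Sph n)) :
    ContMDiffAt (pairModel n) (cotangentModel n) ∞ (toCotangent n) p := by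
  rw [Bundle.contMDiffAt_totalSpace]
  refine ⟨contMDiffAt_fst, ?_⟩
  have h : ContMDiffAt (pairModel n) 𝓘(ℝ, Euc n →L[ℝ] ℝ) ∞
      (fun p' => (toCotangentChart p.1 p').2) p :=
    contDiff_snd.contMDiff.contMDiffAt.comp p (contMDiffAt_toCotangentChart hp)
  refine h.congr_of_eventuallyEq ?_
  filter_upwards [eventually_fst_mem_chart_source p] with p' hp'
  exact trivializationAt_cotangent_snd hp' _

theorem extChartAt_toCotangent {n : ℕ} (p : Sph n × Sph n) :
    (extChartAt (cotangentModel n) (toCotangent n p)) ∘ toCotangent n =ᶠ[𝓝 p]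
      toCotangentChart p.1 := by
  filter_upwards [eventually_fst_mem_chart_source p] with p' hp'
  rw [Function.comp_apply, FiberBundle.extChartAt]
  exact Prod.ext rfl (trivializationAt_cotangent_snd hp' _)

/-! ### Evaluation of the symplectic form. -/

theorem sum_wedge_coord {m : ℕ} (w : Fin 2 → Euc m × (Euc m →L[ℝ] ℝ)) :
    (∑ i : Fin m, wedge (qCoord i) (pCoord i)) w = (w 1).2 (w 0).1 - (w 0).2 (w 1).1 := by
  have key : ∀ (β : Euc m →L[ℝ] ℝ) (v : Euc m),
      ∑ i, v i * β (EuclideanSpace.single i (1 : ℝ)) = β v := by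
    intro β v
    conv_rhs => rw [← (EuclideanSpace.basisFun (Fin m) ℝ).sum_repr v, map_sum]
    simp
  rw [ContinuousAlternatingMap.sum_apply, ← key, ← key, ← Finset.sum_sub_distrib]
  rfl


theorem fderiv_chartInclusion_comp {n : ℕ} (p : Sph n × Sph n)
    (w : TangentSpace (pairModel n) p) :
    fderiv ℝ (chartInclusion p.1) (extChartAt (𝓡 n) p.1 p.1)
      (mfderiv (𝓡 n) 𝓘(ℝ, Euc n) (extChartAt (𝓡 n) p.1) p.1 w.1) = dincl p.1 w.1 := by
  have h1 : MDifferentiableAt (𝓡 n) 𝓘(ℝ, Euc n) (extChartAt (𝓡 n) p.1) p.1 :=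
    (contMDiffAt_extChartAt (n := 1)).mdifferentiableAt one_ne_zero
  have h2 : MDifferentiableAt 𝓘(ℝ, Euc n) 𝓘(ℝ, Euc (n + 1)) (chartInclusion p.1)
      (extChartAt (𝓡 n) p.1 p.1) :=
    ((contDiff_chartInclusion p.1).differentiable (by simp) _).mdifferentiableAt
  have h3 := mfderiv_comp p.1 h2 h1
  have h4 : chartInclusion p.1 ∘ extChartAt (𝓡 n) p.1 =ᶠ[𝓝 p.1]
      fun z : Sph n => (z : Euc (n + 1)) := by
    filter_upwards [chart_source_mem_nhds (Euc n) p.1] with z hz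
    exact congrArg Subtype.val ((extChartAt (𝓡 n) p.1).left_inv (by simpa using hz))
  rw [h4.mfderiv_eq, mfderiv_eq_fderiv] at h3
  exact (DFunLike.congr_fun h3 w.1).symm

/-- The map `(q, s) ↦ (q, ⟨s, dι_q ·⟩)`, where `ι` is the inclusion in a chart. -/
noncomputable def covectorMap {m k : ℕ} (ι : Euc m → Euc k) (z : Euc m × Euc k) :
    Euc m × (Euc m →L[ℝ] ℝ) :=
  (z.1, (innerSL ℝ z.2).comp (fderiv ℝ ι z.1))

theorem hasFDerivAt_covectorMap {m k : ℕ} {ι : Euc m → Euc k} (hι : ContDiff ℝ ∞ ι)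
    (z : Euc m × Euc k) :
    ∃ L : (Euc m × Euc k) →L[ℝ] (Euc m × (Euc m →L[ℝ] ℝ)), HasFDerivAt (covectorMap ι) L z ∧ ∀ d e, (L d).1 = d.1 ∧
      (L d).2 e = ⟪d.2, fderiv ℝ ι z.1 e⟫ + ⟪z.2, fderiv ℝ (fderiv ℝ ι) z.1 d.1 e⟫ := by
  have h1 : HasFDerivAt (fun z : Euc m × Euc k => innerSL ℝ z.2)
      ((innerSL ℝ).comp (ContinuousLinearMap.snd ℝ _ _)) z :=
    (innerSL ℝ).hasFDerivAt.comp z hasFDerivAt_snd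
  have h2 : HasFDerivAt (fun z : Euc m × Euc k => fderiv ℝ ι z.1)
      ((fderiv ℝ (fderiv ℝ ι) z.1).comp (ContinuousLinearMap.fst ℝ _ _)) z :=
    (((hι.fderiv_right (m := ∞) (by simp)).differentiable (by simp) z.1).hasFDerivAt).comp z
      hasFDerivAt_fst
  refine ⟨_, hasFDerivAt_fst.prodMk (h1.clm_comp h2), fun d e => ⟨rfl, ?_⟩⟩
  simp [add_comm]

theorem mfderiv_coe_pair {n : ℕ} (p : Sph n × Sph n) :
    HasMFDerivAt (pairModel n) 𝓘(ℝ, Euc (n + 1) × Euc (n + 1))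
      (fun p : Sph n × Sph n => ((p.1 : Euc (n + 1)), (p.2 : Euc (n + 1)))) p
      (((dincl p.1).comp (ContinuousLinearMap.fst ℝ (Euc n) (Euc n))).prod
        ((dincl p.2).comp (ContinuousLinearMap.snd ℝ (Euc n) (Euc n)))) := by
  have h (x : Sph n) : HasMFDerivAt (𝓡 n) 𝓘(ℝ, Euc (n + 1))
      (fun z : Sph n => (z : Euc (n + 1))) x (dincl x) :=
    ((contMDiff_coe_sph (m := 1)).mdifferentiableAt one_ne_zero).hasMFDerivAt
  have h1 := (h p.1).comp p (hasMFDerivAt_fst (I := 𝓡 n) (I' := 𝓡 n) p)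
  have h2 := (h p.2).comp p (hasMFDerivAt_snd (I := 𝓡 n) (I' := 𝓡 n) p)
  have h3 := (HasMFDerivAt.prodMk h1 h2)
  rw [← modelWithCornersSelf_prod] at h3
  exact h3

/-- The terms of the derivative in the direction of `x` are symmetric in `u`, `u'` and cancel in the
difference, so only the mixed terms survive. -/
theorem mixedForm_antisymm {n : ℕ} {x y : Sph n} (hxy : x ≠ y) (u u' v v' : Euc (n + 1)) (hu : ⟪(x : Euc (n + 1)), u⟫ = 0)
    (hu' : ⟪(x : Euc (n + 1)), u'⟫ = 0) :
    ⟪fderiv ℝ stereoAmbient ((x : Euc (n + 1)), (y : Euc (n + 1))) (u', v'), u⟫ -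
      ⟪fderiv ℝ stereoAmbient ((x : Euc (n + 1)), (y : Euc (n + 1))) (u, v), u'⟫ =
    mixedForm (x : Euc (n + 1)) y u v' - mixedForm (x : Euc (n + 1)) y u' v := by
  have h := (one_sub_inner_pos hxy).ne'
  rw [inner_fderiv_stereoAmbient h _ _ _ hu, inner_fderiv_stereoAmbient h _ _ _ hu']
  simp only [mixedForm, real_inner_comm u u', real_inner_comm (y : Euc (n + 1)),
    real_inner_comm u v', real_inner_comm u' v]
  field_simp
  ring

theorem omegaSphere_apply {n : ℕ} {p : Sph n × Sph n} (hp : p ∈ distinctPairs (Sph n))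
    (w : Fin 2 → TangentSpace (pairModel n) p) :
    omegaSphere n p w =
      mixedForm (p.1 : Euc (n + 1)) p.2 (dincl p.1 (w 0).1) (dincl p.2 (w 1).2) -
      mixedForm (p.1 : Euc (n + 1)) p.2 (dincl p.1 (w 1).1) (dincl p.2 (w 0).2) := by
  have hφ : MDifferentiableAt (pairModel n) (cotangentModel n) (toCotangent n) p :=
    (contMDiffAt_toCotangent hp).mdifferentiableAt (by simp)
  have hψ : MDifferentiableAt (cotangentModel n) 𝓘(ℝ, Euc n × (Euc n →L[ℝ] ℝ))
      (extChartAt (cotangentModel n) (toCotangent n p)) (toCotangent n p) :=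
    (contMDiffAt_extChartAt (n := 1)).mdifferentiableAt one_ne_zero
  have hcomp := mfderiv_comp p hψ hφ
  rw [(extChartAt_toCotangent p).mfderiv_eq] at hcomp
  have h1 : HasMFDerivAt (𝓡 n) 𝓘(ℝ, Euc n) (extChartAt (𝓡 n) p.1) p.1
      (mfderiv (𝓡 n) 𝓘(ℝ, Euc n) (extChartAt (𝓡 n) p.1) p.1) :=
    ((contMDiffAt_extChartAt (n := 1)).mdifferentiableAt one_ne_zero).hasMFDerivAt
  have h2 := h1.comp p (hasMFDerivAt_fst (I := 𝓡 n) (I' := 𝓡 n) p)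
  have h3 := ((((contDiffAt_stereoAmbient (p := ((p.1 : Euc (n + 1)), (p.2 : Euc (n + 1))))
    (one_sub_inner_pos hp).ne').differentiableAt (by simp)).hasFDerivAt).hasMFDerivAt).comp p
    (mfderiv_coe_pair p)
  have h4 := HasMFDerivAt.prodMk h2 h3
  -- The product of two vector spaces as manifolds is replaced by the product vector space with its
  -- own model, where `hL` lives.
  rw [← modelWithCornersSelf_prod, ← chartedSpaceSelf_prod] at h4
  obtain ⟨L, hL, hL'⟩ := hasFDerivAt_covectorMap (contDiff_chartInclusion p.1)
    (extChartAt (𝓡 n) p.1 p.1, stereo p.1 p.2)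
  have h5 := HasMFDerivAt.comp p hL.hasMFDerivAt h4
  have h6 := hcomp.symm.trans h5.mfderiv
  have h7 : omegaSphere n p w = (∑ i : Fin n, wedge (qCoord i) (pCoord i))
    (fun i => L (mfderiv (𝓡 n) 𝓘(ℝ, Euc n) (extChartAt (𝓡 n) p.1) p.1 (w i).1,
      fderiv ℝ stereoAmbient ((p.1 : Euc (n + 1)), (p.2 : Euc (n + 1)))
        (dincl p.1 (w i).1, dincl p.2 (w i).2))) := by
    refine congrArg (DFunLike.coe (∑ i : Fin n, wedge (qCoord i) (pCoord i))) ?_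
    funext i
    exact DFunLike.congr_fun h6 (w i)
  rw [h7, sum_wedge_coord, (hL' _ _).2, (hL' _ _).2, (hL' _ 0).1, (hL' _ 0).1,
    fderiv_chartInclusion_comp, fderiv_chartInclusion_comp]
  -- The two remaining second-derivative terms of the inclusion agree by symmetry and cancel.
  have hsymm := ((contDiff_chartInclusion p.1).contDiffAt
    (x := extChartAt (𝓡 n) p.1 p.1)).isSymmSndFDerivAt
      (by simpa using WithTop.coe_le_coe.2 (le_top (a := (2 : ℕ∞))))
  rw [hsymm (mfderiv (𝓡 n) 𝓘(ℝ, Euc n) (extChartAt (𝓡 n) p.1) p.1 (w 1).1), add_sub_add_right_eq_sub]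
  exact mixedForm_antisymm hp _ _ _ _ (inner_dincl_self _ _) (inner_dincl_self _ _)

/-! ### Bijectivity of `φ`. -/

theorem inner_stereo {n : ℕ} (x y : Sph n) : ⟪(x : Euc (n + 1)), stereo x y⟫ = 0 := by
  simp [stereo, inner_smul_right, inner_sub_right]

theorem norm_sq_stereo {n : ℕ} {x y : Sph n} (h : x ≠ y) :
    ⟪stereo x y, stereo x y⟫ * (1 - ⟪(x : Euc (n + 1)), y⟫) = 1 + ⟪(x : Euc (n + 1)), y⟫ := by
  have h1 := (one_sub_inner_pos h).ne'
  simp only [stereo, inner_smul_right, inner_smul_left, inner_sub_right, inner_sub_left,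
    inner_self_sph, real_inner_comm (x : Euc (n + 1)), conj_trivial]
  field_simp
  ring

theorem coe_eq_of_stereo {n : ℕ} {x y : Sph n} (h : x ≠ y) :
    (y : Euc (n + 1)) = (1 - ⟪(x : Euc (n + 1)), y⟫) • stereo x y
      + ⟪(x : Euc (n + 1)), y⟫ • (x : Euc (n + 1)) := by
  rw [stereo, smul_inv_smul₀ (one_sub_inner_pos h).ne', sub_add_cancel]

theorem stereo_injOn {n : ℕ} {x y y' : Sph n} (h : x ≠ y) (h' : x ≠ y')
    (he : stereo x y = stereo x y') : y = y' := by
  have h1 := norm_sq_stereo h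
  have h2 := norm_sq_stereo h'
  rw [← he] at h2
  have h3 : 0 ≤ ⟪stereo x y, stereo x y⟫ := real_inner_self_nonneg
  -- With `s` the squared norm of the projection, both inner products solve `(s + 1) c = s - 1`.
  have h4 : ⟪(x : Euc (n + 1)), y⟫ = ⟪(x : Euc (n + 1)), y'⟫ := by
    have : (⟪stereo x y, stereo x y⟫ + 1) * (⟪(x : Euc (n + 1)), y⟫ - ⟪(x : Euc (n + 1)), y'⟫) = 0 := by
      linarith
    rcases mul_eq_zero.1 this with h | h <;> linarith
  refine Subtype.ext ?_
  rw [coe_eq_of_stereo h, coe_eq_of_stereo h', he, h4]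

theorem exists_stereo_eq {n : ℕ} (x : Sph n) {v : Euc (n + 1)} (hv : ⟪(x : Euc (n + 1)), v⟫ = 0) :
    ∃ y : Sph n, x ≠ y ∧ stereo x y = v := by
  set s : ℝ := ⟪v, v⟫ with hs
  have h3 : 0 ≤ s := real_inner_self_nonneg
  have h4 : s + 1 ≠ 0 := by positivity
  -- This is `(1 - c) v + c x`, as in `coe_eq_of_stereo`, with `c = (s - 1) / (s + 1)` forced by
  -- `norm_sq_stereo`.
  set z : Euc (n + 1) := (s + 1)⁻¹ • ((s - 1) • (x : Euc (n + 1)) + (2 : ℝ) • v) with hz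
  have hxz : ⟪(x : Euc (n + 1)), z⟫ = (s - 1) / (s + 1) := by
    simp only [hz, inner_smul_right, inner_add_right, inner_self_sph, hv]
    field_simp
    ring
  have hzz : ⟪z, z⟫ = 1 := by
    simp only [hz, inner_smul_right, inner_smul_left, inner_add_right, inner_add_left,
      inner_self_sph, hv, real_inner_comm (x : Euc (n + 1)) v, conj_trivial, ← hs]
    field_simp
    ring
  have h5 : (1 : ℝ) - (s - 1) / (s + 1) = 2 / (s + 1) := by field_simp; ring
  have hmem : z ∈ sphere (0 : Euc (n + 1)) 1 := by
    rw [mem_sphere_zero_iff_norm, norm_eq_sqrt_real_inner, hzz, Real.sqrt_one]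
  refine ⟨⟨z, hmem⟩, fun h => ?_, ?_⟩
  · have h6 := inner_self_sph x
    nth_rewrite 2 [h] at h6
    change ⟪(x : Euc (n + 1)), z⟫ = 1 at h6
    rw [hxz, div_eq_one_iff_eq h4] at h6
    linarith
  · change (1 - ⟪(x : Euc (n + 1)), z⟫)⁻¹ • (z - ⟪(x : Euc (n + 1)), z⟫ • (x : Euc (n + 1))) = v
    rw [hxz, h5, hz, smul_add, smul_smul, smul_smul, add_sub_right_comm, ← sub_smul, smul_add,
      smul_smul, smul_smul]
    have h6 : (2 / (s + 1))⁻¹ * ((s + 1)⁻¹ * (s - 1) - (s - 1) / (s + 1)) = 0 := by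
      field_simp; ring
    have h7 : (2 / (s + 1))⁻¹ * ((s + 1)⁻¹ * 2) = 1 := by field_simp
    rw [h6, h7, zero_smul, zero_add, one_smul]

theorem eq_zero_of_inner_dincl {n : ℕ} (x : Sph n) {v : Euc (n + 1)}
    (hv : ⟪(x : Euc (n + 1)), v⟫ = 0) (h : ∀ u, ⟪v, dincl x u⟫ = 0) : v = 0 := by
  obtain ⟨u, hu⟩ := exists_dincl_eq x hv
  have := h u
  rwa [hu, inner_self_eq_zero] at this

/-- A left inverse of `dincl x` extends `ξ` to the ambient space; the Riesz vector of the extension,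
with its `x` component removed, represents `ξ`. -/
theorem exists_inner_dincl_eq {n : ℕ} (x : Sph n) (ξ : TangentSpace (𝓡 n) x →L[ℝ] ℝ) :
    ∃ v : Euc (n + 1), ⟪(x : Euc (n + 1)), v⟫ = 0 ∧ ∀ u, ⟪v, dincl x u⟫ = ξ u := by
  obtain ⟨g, hg⟩ := LinearMap.exists_leftInverse_of_injective (dincl x).toLinearMap
    (LinearMap.ker_eq_bot.2 (dincl_injective x))
  set f : Euc (n + 1) →L[ℝ] ℝ := LinearMap.toContinuousLinearMap (ξ.toLinearMap.comp g) with hf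
  set v := (InnerProductSpace.toDual ℝ (Euc (n + 1))).symm f with hv
  have h1 : ∀ w, ⟪v, w⟫ = f w := fun w => InnerProductSpace.toDual_symm_apply
  refine ⟨v - ⟪(x : Euc (n + 1)), v⟫ • (x : Euc (n + 1)), ?_, fun u => ?_⟩
  · simp [inner_sub_right, inner_smul_right]
  · rw [inner_sub_left, inner_smul_left, inner_dincl_self, mul_zero, sub_zero, h1]
    exact congrArg ξ (LinearMap.congr_fun hg u)

theorem bijOn_toCotangent (n : ℕ) : BijOn (toCotangent n) (distinctPairs (Sph n)) univ := by
  refine ⟨mapsTo_univ _ _, ?_, ?_⟩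
  · rintro ⟨x, y⟩ hxy ⟨x', y'⟩ hxy' h
    obtain rfl : x = x' := congrArg Bundle.TotalSpace.proj h
    have h1 : toCovector x y = toCovector x y' := by
      simpa [toCotangent] using h
    have h2 : stereo x y - stereo x y' = 0 := by
      refine eq_zero_of_inner_dincl x (by simp [inner_sub_right, inner_stereo]) fun u => ?_
      rw [inner_sub_left, sub_eq_zero]
      exact DFunLike.congr_fun h1 u
    exact Prod.ext rfl (stereo_injOn hxy hxy' (sub_eq_zero.1 h2))
  · rintro ⟨x, ξ⟩ -
    obtain ⟨v, hv, hξ⟩ := exists_inner_dincl_eq x ξ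
    obtain ⟨y, hxy, rfl⟩ := exists_stereo_eq x hv
    refine ⟨(x, y), hxy, ?_⟩
    have : toCovector x y = ξ := ContinuousLinearMap.ext fun u => hξ u
    simp [toCotangent, this]

/-! ### Pull-backs of `ω_{S^n}` and maps into the sphere. -/

theorem pullback_omegaSphere_apply {n : ℕ} {E H M : Type*}
    [NormedAddCommGroup E] [NormedSpace ℝ E] [TopologicalSpace H] {I : ModelWithCorners ℝ E H}
    [TopologicalSpace M] [ChartedSpace H M] {F : M → Sph n × Sph n} {p : M}
    {F' : TangentSpace I p →L[ℝ] TangentSpace (pairModel n) (F p)}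
    (hF : HasMFDerivAt I (pairModel n) F p F') (hp : F p ∈ distinctPairs (Sph n))
    (w : Fin 2 → TangentSpace I p) :
    pullback I (pairModel n) F (omegaSphere n) p w =
      mixedForm ((F p).1 : Euc (n + 1)) (F p).2
        (dincl (F p).1 (F' (w 0)).1) (dincl (F p).2 (F' (w 1)).2) -
      mixedForm ((F p).1 : Euc (n + 1)) (F p).2
        (dincl (F p).1 (F' (w 1)).1) (dincl (F p).2 (F' (w 0)).2) := by
  rw [pullback, hF.mfderiv]
  exact omegaSphere_apply hp _

theorem dincl_mfderiv {n : ℕ} {E H M : Type*}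
    [NormedAddCommGroup E] [NormedSpace ℝ E] [TopologicalSpace H] {I : ModelWithCorners ℝ E H}
    [TopologicalSpace M] [ChartedSpace H M] {f : M → Sph n} {x : M}
    (hf : MDifferentiableAt I (𝓡 n) f x) (u : TangentSpace I x) :
    dincl (f x) (mfderiv I (𝓡 n) f x u) =
      mfderiv I 𝓘(ℝ, Euc (n + 1)) (fun z => (f z : Euc (n + 1))) x u := by
  have h : MDifferentiableAt (𝓡 n) 𝓘(ℝ, Euc (n + 1)) (fun z : Sph n => (z : Euc (n + 1))) (f x) :=
    (contMDiff_coe_sph (m := 1)).mdifferentiableAt one_ne_zero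
  exact (DFunLike.congr_fun (mfderiv_comp x h hf) u).symm

theorem contMDiff_sph_of_coe {n : ℕ} {m : ℕ∞ω} {E H M : Type*}
    [NormedAddCommGroup E] [NormedSpace ℝ E] [TopologicalSpace H] {I : ModelWithCorners ℝ E H}
    [TopologicalSpace M] [ChartedSpace H M] [IsManifold I m M] {f : M → Sph n}
    (hf : ContMDiff I 𝓘(ℝ, Euc (n + 1)) m (fun z => (f z : Euc (n + 1)))) :
    ContMDiff I (𝓡 n) m f := by
  have : Fact (Module.finrank ℝ (Euc (n + 1)) = n + 1) := ⟨finrank_euclideanSpace_fin⟩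
  exact hf.codRestrict_sphere (n := n) (fun x => (f x).2)

/-! ### Light cone model and Möbius invariance. -/

/-- The Lorentz form `⟨x, y⟩ - a b` on `ℝ × ℝ^m`. -/
noncomputable def lorentzForm {m : ℕ} (X Y : ℝ × Euc m) : ℝ := ⟪X.2, Y.2⟫ - X.1 * Y.1

theorem lorentzForm_add_left {m : ℕ} (X Y Z : ℝ × Euc m) :
    lorentzForm (X + Y) Z = lorentzForm X Z + lorentzForm Y Z := by
  simp [lorentzForm, inner_add_left]; ring

theorem lorentzForm_add_right {m : ℕ} (X Y Z : ℝ × Euc m) :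
    lorentzForm Z (X + Y) = lorentzForm Z X + lorentzForm Z Y := by
  simp [lorentzForm, inner_add_right]; ring

theorem lorentzForm_smul_left {m : ℕ} (c : ℝ) (X Z : ℝ × Euc m) :
    lorentzForm (c • X) Z = c * lorentzForm X Z := by
  simp [lorentzForm, inner_smul_left]; ring

theorem lorentzForm_smul_right {m : ℕ} (c : ℝ) (X Z : ℝ × Euc m) :
    lorentzForm Z (c • X) = c * lorentzForm Z X := by
  simp [lorentzForm, inner_smul_right]; ring

/-- The mixed part of the form `ω_{S^n}`, on the light cone. -/
noncomputable def lorentzMixedForm {m : ℕ} (X Y U V : ℝ × Euc m) : ℝ :=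
  lorentzForm U V / (-lorentzForm X Y) + lorentzForm U Y * lorentzForm X V / lorentzForm X Y ^ 2

theorem mixedForm_eq_lorentz {m : ℕ} (x y u v : Euc m) :
    mixedForm x y u v = lorentzMixedForm (1, x) (1, y) (0, u) (0, v) := by
  simp only [mixedForm, lorentzMixedForm, lorentzForm]
  rw [show -(⟪x, y⟫ - 1 * 1) = 1 - ⟪x, y⟫ by ring, ← neg_sq (⟪x, y⟫ - 1 * 1)]
  simp

/-- `c'` and `d'` play the role of the derivatives of the scale factors `c` and `d`: this is the
invariance of a mixed derivative of `log` under one-variable factors. It is purely algebraic, and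
`X`, `Y` need not be null. -/
theorem lorentzMixedForm_rescale {m : ℕ} {X Y U V : ℝ × Euc m} (h : lorentzForm X Y ≠ 0)
    {c d : ℝ} (hc : c ≠ 0) (hd : d ≠ 0) (c' d' : ℝ) :
    lorentzMixedForm (c • X) (d • Y) (c' • X + c • U) (d' • Y + d • V) =
      lorentzMixedForm X Y U V := by
  simp only [lorentzMixedForm, lorentzForm_add_left, lorentzForm_add_right,
    lorentzForm_smul_left, lorentzForm_smul_right]
  field_simp
  ring

/-- `ℝ^(m+1)` as `ℝ × ℝ^m`. -/
noncomputable def consEquiv (m : ℕ) : (ℝ × Euc m) ≃ₗ[ℝ] (Fin (m + 1) → ℝ) :=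
  ((LinearEquiv.refl ℝ ℝ).prodCongr (WithLp.linearEquiv 2 ℝ (Fin m → ℝ))).trans
    (Fin.consLinearEquiv ℝ (fun _ : Fin (m + 1) => ℝ))

theorem consEquiv_apply {m : ℕ} (X : ℝ × Euc m) :
    consEquiv m X = Fin.cons X.1 (fun i => X.2 i) := rfl

theorem dotProduct_lorentzGram {n : ℕ} (X Y : ℝ × Euc (n + 1)) :
    consEquiv (n + 1) X ⬝ᵥ (lorentzGram n).mulVec (consEquiv (n + 1) Y) = lorentzForm X Y := by
  rw [consEquiv_apply, consEquiv_apply, lorentzGram, lorentzForm, dotProduct, Fin.sum_univ_succ]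
  simp only [Matrix.mulVec_diagonal, Fin.cons_zero, Fin.cons_succ, PiLp.inner_apply,
    RCLike.inner_apply, conj_trivial, one_mul, mul_comm]
  ring

theorem isMoebius_exists_linearMap {n : ℕ} {T : Sph n → Sph n} (hT : IsMoebius T) :
    ∃ M : (ℝ × Euc (n + 1)) →L[ℝ] (ℝ × Euc (n + 1)),
      (∀ X Y, lorentzForm (M X) (M Y) = lorentzForm X Y) ∧
      ∀ x : Sph n, ∃ c : ℝ, c ≠ 0 ∧
        M (1, (x : Euc (n + 1))) = c • ((1 : ℝ), (T x : Euc (n + 1))) := by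
  obtain ⟨A, hA, hAT⟩ := hT
  have key : ∀ X, consEquiv (n + 1) ((consEquiv (n + 1)).symm
      (A.mulVec (consEquiv (n + 1) X))) = A.mulVec (consEquiv (n + 1) X) :=
    fun X => LinearEquiv.apply_symm_apply _ _
  refine ⟨LinearMap.toContinuousLinearMap ((consEquiv (n + 1)).symm.toLinearMap.comp
    (A.mulVecLin.comp (consEquiv (n + 1)).toLinearMap)), fun X Y => ?_, fun x => ?_⟩
  · change lorentzForm ((consEquiv (n + 1)).symm (A.mulVec (consEquiv (n + 1) X)))
      ((consEquiv (n + 1)).symm (A.mulVec (consEquiv (n + 1) Y))) = _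
    rw [← dotProduct_lorentzGram, key, key, ← dotProduct_lorentzGram, Matrix.mulVec_mulVec,
      ← Matrix.vecMul_transpose, ← Matrix.dotProduct_mulVec, Matrix.mulVec_mulVec, ← Matrix.mul_assoc,
      hA]
  · obtain ⟨c, hc, h⟩ := hAT x
    refine ⟨c, hc, (consEquiv (n + 1)).injective ?_⟩
    rw [map_smul]
    exact (key _).trans h

section Moebius

variable {n : ℕ} {T : Sph n → Sph n} {M : (ℝ × Euc (n + 1)) →L[ℝ] (ℝ × Euc (n + 1))}

theorem moebius_fst_ne_zero
    (hM : ∀ x : Sph n, ∃ c : ℝ, c ≠ 0 ∧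
      M (1, (x : Euc (n + 1))) = c • ((1 : ℝ), (T x : Euc (n + 1)))) (x : Sph n) :
    (M (1, (x : Euc (n + 1)))).1 ≠ 0 := by
  obtain ⟨c, hc, h⟩ := hM x
  simpa [h] using hc

theorem moebius_apply
    (hM : ∀ x : Sph n, ∃ c : ℝ, c ≠ 0 ∧
      M (1, (x : Euc (n + 1))) = c • ((1 : ℝ), (T x : Euc (n + 1)))) (x : Sph n) :
    M (1, (x : Euc (n + 1))) = (M (1, (x : Euc (n + 1)))).1 • ((1 : ℝ), (T x : Euc (n + 1))) := by
  obtain ⟨c, hc, h⟩ := hM x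
  simp [h]

/-- The projective action of a linear map of `ℝ × ℝ^m`. -/
noncomputable def projAction {m : ℕ} (M : (ℝ × Euc m) →L[ℝ] (ℝ × Euc m)) (z : Euc m) : Euc m :=
  (M (1, z)).1⁻¹ • (M (1, z)).2

theorem contDiffAt_projAction {m : ℕ} {M : (ℝ × Euc m) →L[ℝ] (ℝ × Euc m)} {z : Euc m}
    (h : (M (1, z)).1 ≠ 0) : ContDiffAt ℝ ∞ (projAction M) z := by
  have h1 : ContDiff ℝ ∞ (fun z => M (1, z)) := M.contDiff.comp (contDiff_const.prodMk contDiff_id)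
  exact ((contDiff_fst.comp h1).contDiffAt.inv h).smul (contDiff_snd.comp h1).contDiffAt

/-- The product rule for `M (1, z) = (M (1, z)).1 • (1, projAction M z)`, put in the shape that
`lorentzMixedForm_rescale` consumes. -/
theorem projAction_fderiv {m : ℕ} {M : (ℝ × Euc m) →L[ℝ] (ℝ × Euc m)} {z : Euc m}
    (h : (M (1, z)).1 ≠ 0) (u : Euc m) :
    M (0, u) = (M (0, u)).1 • (1, projAction M z) +
      (M (1, z)).1 • (0, fderiv ℝ (projAction M) z u) := by
  have h0 : HasFDerivAt (fun z => M (1, z)) (M.comp (ContinuousLinearMap.inr ℝ ℝ (Euc m))) z :=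
    M.hasFDerivAt.comp z (hasFDerivAt_prodMk_right 1 z)
  have h1 := h0.fst
  have h2 := h0.snd
  have h3 := ((contDiffAt_projAction h).differentiableAt (by simp)).hasFDerivAt
  have h4 := h1.smul h3
  have h5 : (fun z => (M (1, z)).1 • projAction M z) =ᶠ[𝓝 z] fun z => (M (1, z)).2 := by
    filter_upwards [h1.continuousAt.eventually_ne h] with z' hz'
    exact smul_inv_smul₀ hz' _
  have h6 := DFunLike.congr_fun ((h4.congr_of_eventuallyEq h5.symm).unique h2) u
  refine Prod.ext (by simp) ?_
  simp only [add_apply, smul_apply,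
    ContinuousLinearMap.smulRight_apply, ContinuousLinearMap.comp_apply,
    ContinuousLinearMap.inr_apply, ContinuousLinearMap.coe_fst', ContinuousLinearMap.coe_snd'] at h6
  simp only [Prod.snd_add, Prod.smul_snd]
  rw [← h6, add_comm]

theorem coe_moebius
    (hM : ∀ x : Sph n, ∃ c : ℝ, c ≠ 0 ∧
      M (1, (x : Euc (n + 1))) = c • ((1 : ℝ), (T x : Euc (n + 1)))) (x : Sph n) :
    (T x : Euc (n + 1)) = projAction M x := by
  rw [projAction, moebius_apply hM x]
  simp [moebius_fst_ne_zero hM x]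

theorem contMDiff_moebius
    (hM : ∀ x : Sph n, ∃ c : ℝ, c ≠ 0 ∧
      M (1, (x : Euc (n + 1))) = c • ((1 : ℝ), (T x : Euc (n + 1)))) :
    ContMDiff (𝓡 n) (𝓡 n) ∞ T := by
  refine contMDiff_sph_of_coe ?_
  simp_rw [coe_moebius hM]
  intro x
  exact ContMDiffAt.comp (g := projAction M) x
    (contDiffAt_projAction (moebius_fst_ne_zero hM x)).contMDiffAt contMDiff_coe_sph.contMDiffAt

theorem dincl_mfderiv_moebius
    (hM : ∀ x : Sph n, ∃ c : ℝ, c ≠ 0 ∧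
      M (1, (x : Euc (n + 1))) = c • ((1 : ℝ), (T x : Euc (n + 1)))) (x : Sph n)
    (u : TangentSpace (𝓡 n) x) :
    dincl (T x) (mfderiv (𝓡 n) (𝓡 n) T x u) = fderiv ℝ (projAction M) x (dincl x u) := by
  have h1 : HasMFDerivAt (𝓡 n) 𝓘(ℝ, Euc (n + 1)) (fun z : Sph n => (z : Euc (n + 1))) x
      (dincl x) :=
    ((contMDiff_coe_sph (m := 1)).mdifferentiableAt one_ne_zero).hasMFDerivAt
  have h2 := ((contDiffAt_projAction (moebius_fst_ne_zero hM x)).differentiableAt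
      (by simp)).hasFDerivAt.hasMFDerivAt
  have h3 := HasMFDerivAt.comp x h2 h1
  have h4 : projAction M ∘ (fun z : Sph n => (z : Euc (n + 1))) =
      fun z => (T z : Euc (n + 1)) := funext fun z => (coe_moebius hM z).symm
  rw [h4] at h3
  refine (dincl_mfderiv ((contMDiff_moebius hM).mdifferentiableAt (by simp)) u).trans ?_
  rw [h3.mfderiv]
  rfl

theorem lorentzForm_light {x y : Sph n} :
    lorentzForm (1, (x : Euc (n + 1))) (1, (y : Euc (n + 1))) = -(1 - ⟪(x : Euc (n + 1)), y⟫) := by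
  simp [lorentzForm]

/-- Equal images would have Lorentz product zero, whereas distinct points have light vectors of
nonzero product, and `M` preserves the product. -/
theorem moebius_ne (hML : ∀ X Y, lorentzForm (M X) (M Y) = lorentzForm X Y)
    (hM : ∀ x : Sph n, ∃ c : ℝ, c ≠ 0 ∧
      M (1, (x : Euc (n + 1))) = c • ((1 : ℝ), (T x : Euc (n + 1)))) {x y : Sph n} (h : x ≠ y) :
    T x ≠ T y := by
  intro hT
  have h1 := hML (1, (x : Euc (n + 1))) (1, (y : Euc (n + 1)))
  rw [moebius_apply hM x, moebius_apply hM y, hT, lorentzForm_smul_left, lorentzForm_smul_right,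
    lorentzForm_light, lorentzForm_light, inner_self_sph] at h1
  linarith [one_sub_inner_pos h]

theorem mixedForm_moebius (hML : ∀ X Y, lorentzForm (M X) (M Y) = lorentzForm X Y)
    (hM : ∀ x : Sph n, ∃ c : ℝ, c ≠ 0 ∧
      M (1, (x : Euc (n + 1))) = c • ((1 : ℝ), (T x : Euc (n + 1)))) {x y : Sph n} (h : x ≠ y)
    (u v : Euc (n + 1)) :
    mixedForm (T x : Euc (n + 1)) (T y) (fderiv ℝ (projAction M) x u)
      (fderiv ℝ (projAction M) y v) = mixedForm (x : Euc (n + 1)) y u v := by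
  have hT : lorentzForm (1, (T x : Euc (n + 1))) (1, (T y : Euc (n + 1))) ≠ 0 := by
    rw [lorentzForm_light]
    exact (neg_neg_of_pos (one_sub_inner_pos (moebius_ne hML hM h))).ne
  rw [mixedForm_eq_lorentz, mixedForm_eq_lorentz,
    ← lorentzMixedForm_rescale hT (moebius_fst_ne_zero hM x) (moebius_fst_ne_zero hM y)
      (M (0, u)).1 (M (0, v)).1, ← moebius_apply hM, ← moebius_apply hM,
    coe_moebius hM, coe_moebius hM, ← projAction_fderiv (moebius_fst_ne_zero hM x),
    ← projAction_fderiv (moebius_fst_ne_zero hM y)]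
  simp only [lorentzMixedForm, hML]

theorem pullback_moebius (hML : ∀ X Y, lorentzForm (M X) (M Y) = lorentzForm X Y)
    (hM : ∀ x : Sph n, ∃ c : ℝ, c ≠ 0 ∧
      M (1, (x : Euc (n + 1))) = c • ((1 : ℝ), (T x : Euc (n + 1)))) {p : Sph n × Sph n}
    (hp : p ∈ distinctPairs (Sph n)) :
    pullback (pairModel n) (pairModel n) (Prod.map T T) (omegaSphere n) p = omegaSphere n p := by
  have hd (x : Sph n) : HasMFDerivAt (𝓡 n) (𝓡 n) T x (mfderiv (𝓡 n) (𝓡 n) T x) :=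
    ((contMDiff_moebius hM).mdifferentiableAt (by simp)).hasMFDerivAt
  have h := HasMFDerivAt.prodMk ((hd p.1).comp p (hasMFDerivAt_fst (I := 𝓡 n) (I' := 𝓡 n) p))
    ((hd p.2).comp p (hasMFDerivAt_snd (I := 𝓡 n) (I' := 𝓡 n) p))
  ext w
  rw [omegaSphere_apply hp]
  refine (pullback_omegaSphere_apply (F := Prod.map T T) h (moebius_ne hML hM hp) w).trans ?_
  have h1 (u : TangentSpace (𝓡 n) p.1) (v : TangentSpace (𝓡 n) p.2) :
      mixedForm (T p.1 : Euc (n + 1)) (T p.2) (dincl (T p.1) (mfderiv (𝓡 n) (𝓡 n) T p.1 u))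
        (dincl (T p.2) (mfderiv (𝓡 n) (𝓡 n) T p.2 v)) =
      mixedForm (p.1 : Euc (n + 1)) p.2 (dincl p.1 u) (dincl p.2 v) := by
    rw [dincl_mfderiv_moebius hM, dincl_mfderiv_moebius hM]
    exact mixedForm_moebius hML hM hp _ _
  exact congrArg₂ (· - ·) (h1 (w 0).1 (w 1).2) (h1 (w 1).1 (w 0).2)

end Moebius

/-! ### Inverse stereographic projection and the chord form. -/

/-- The coordinates on the unit sphere of `ℝ^3` of the point with stereographic image `ζ`. -/
noncomputable def stereoCoord (ζ : ℂ) : Fin 3 → ℝ :=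
  ![2 * ζ.re / (ζ.re ^ 2 + ζ.im ^ 2 + 1), 2 * ζ.im / (ζ.re ^ 2 + ζ.im ^ 2 + 1),
    (ζ.re ^ 2 + ζ.im ^ 2 - 1) / (ζ.re ^ 2 + ζ.im ^ 2 + 1)]

/-- The derivative of `stereoCoord` at `ζ` in the direction `a`. -/
noncomputable def stereoCoordDeriv (ζ a : ℂ) : Fin 3 → ℝ :=
  ![2 * a.re / (ζ.re ^ 2 + ζ.im ^ 2 + 1)
      - 4 * (ζ.re * a.re + ζ.im * a.im) * ζ.re / (ζ.re ^ 2 + ζ.im ^ 2 + 1) ^ 2,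
    2 * a.im / (ζ.re ^ 2 + ζ.im ^ 2 + 1)
      - 4 * (ζ.re * a.re + ζ.im * a.im) * ζ.im / (ζ.re ^ 2 + ζ.im ^ 2 + 1) ^ 2,
    4 * (ζ.re * a.re + ζ.im * a.im) / (ζ.re ^ 2 + ζ.im ^ 2 + 1) ^ 2]

theorem invStereo_eq {m : ℕ} (q : Euc m) (ρ : ℝ) (e : Fin 3 → Euc m) (ζ : ℂ) :
    invStereo q ρ e ζ = q + ρ • ∑ i, stereoCoord ζ i • e i := by
  simp only [invStereo, stereoCoord, Fin.sum_univ_three, Complex.sq_norm, Complex.normSq_apply,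
    Matrix.cons_val_zero, Matrix.cons_val_one, Matrix.cons_val, smul_add, smul_smul]
  simp only [div_eq_mul_inv, ← pow_two]
  congr 1
  congr 1
  · congr 1 <;> congr 1 <;> ring
  · congr 1; ring

theorem fderiv_invStereo_apply {m : ℕ} (q : Euc m) (ρ : ℝ) (e : Fin 3 → Euc m) (ζ a : ℂ) :
    DifferentiableAt ℝ (invStereo q ρ e) ζ ∧
    fderiv ℝ (invStereo q ρ e) ζ a = ρ • ∑ i, stereoCoordDeriv ζ a i • e i := by
  have hre : HasFDerivAt (fun ζ : ℂ => ζ.re) Complex.reCLM ζ := Complex.reCLM.hasFDerivAt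
  have him : HasFDerivAt (fun ζ : ℂ => ζ.im) Complex.imCLM ζ := Complex.imCLM.hasFDerivAt
  have hs := (hre.pow 2).add (him.pow 2)
  have hN : ζ.re ^ 2 + ζ.im ^ 2 + 1 ≠ 0 := by positivity
  have hi := (hasDerivAt_inv hN).comp_hasFDerivAt ζ (hs.add_const 1)
  have h := (((((hre.const_mul 2).mul hi).smul_const (e 0)).add
    (((him.const_mul 2).mul hi).smul_const (e 1))).add
    (((hs.sub_const 1).mul hi).smul_const (e 2))).const_smul ρ |>.const_add q
  have hf : invStereo q ρ e = fun ζ => q + ρ • ((2 * ζ.re * (ζ.re ^ 2 + ζ.im ^ 2 + 1)⁻¹) • e 0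
      + (2 * ζ.im * (ζ.re ^ 2 + ζ.im ^ 2 + 1)⁻¹) • e 1
      + ((ζ.re ^ 2 + ζ.im ^ 2 - 1) * (ζ.re ^ 2 + ζ.im ^ 2 + 1)⁻¹) • e 2) := by
    funext ζ
    rw [invStereo_eq]
    simp [stereoCoord, Fin.sum_univ_three, div_eq_mul_inv]
  rw [hf]
  refine ⟨h.differentiableAt, ?_⟩
  refine (DFunLike.congr_fun h.fderiv a).trans ?_
  simp only [stereoCoordDeriv, Fin.sum_univ_three, Matrix.cons_val_zero, Matrix.cons_val_one,
    Matrix.cons_val]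
  simp
  congr 1
  · congr 1 <;> congr 2 <;> field_simp <;> ring
  · congr 2; field_simp; ring

theorem inner_orthonormal_sum {m : ℕ} {e : Fin 3 → Euc m} (he : Orthonormal ℝ e)
    (α β : Fin 3 → ℝ) : ⟪∑ i, α i • e i, ∑ i, β i • e i⟫ = α 0 * β 0 + α 1 * β 1 + α 2 * β 2 := by
  rw [he.inner_sum]
  simp [Fin.sum_univ_three]

/-- The bilinear form `2 ⟨u, v⟩ / |d|² - 4 ⟨d, u⟩ ⟨d, v⟩ / |d|⁴`. -/
noncomputable def chordForm {m : ℕ} (d u v : Euc m) : ℝ :=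
  2 * ⟪u, v⟫ / ⟪d, d⟫ - 4 * (⟪d, u⟫ * ⟪d, v⟫) / ⟪d, d⟫ ^ 2

/-- On the unit sphere `|x - y|² = 2 (1 - ⟨x, y⟩)`, and tangency turns pairings with `x - y` into
pairings with one endpoint. The chord form depends on the points only through their difference, so
the centre of the two-sphere no longer matters. -/
theorem mixedForm_eq_chordForm {m : ℕ} {x y u v : Euc m} (hx : ⟪x, x⟫ = 1) (hy : ⟪y, y⟫ = 1)
    (hxu : ⟪x, u⟫ = 0) (hyv : ⟪y, v⟫ = 0) (hxy : 1 - ⟪x, y⟫ ≠ 0) :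
    mixedForm x y u v = chordForm (x - y) u v := by
  have h : ⟪x - y, x - y⟫ = 2 * (1 - ⟪x, y⟫) := by
    simp only [inner_sub_left, inner_sub_right, hx, hy, real_inner_comm x y]; ring
  rw [mixedForm, chordForm, h, inner_sub_left, inner_sub_left, hxu, hyv, real_inner_comm u y]
  field_simp
  ring

section Frame

variable {m : ℕ} {q : Euc m} {ρ : ℝ} {e : Fin 3 → Euc m}

theorem invStereo_sub (X Y : ℂ) : invStereo q ρ e X - invStereo q ρ e Y =
    ρ • ∑ i, (stereoCoord X i - stereoCoord Y i) • e i := by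
  rw [invStereo_eq, invStereo_eq, add_sub_add_left_eq_sub, ← smul_sub, ← Finset.sum_sub_distrib]
  simp_rw [sub_smul]

theorem inner_invStereo_sub_self (he : Orthonormal ℝ e) (X Y : ℂ) :
    ⟪invStereo q ρ e X - invStereo q ρ e Y, invStereo q ρ e X - invStereo q ρ e Y⟫ =
    4 * ρ ^ 2 * ((X.re - Y.re) ^ 2 + (X.im - Y.im) ^ 2) /
      ((X.re ^ 2 + X.im ^ 2 + 1) * (Y.re ^ 2 + Y.im ^ 2 + 1)) := by
  rw [invStereo_sub, inner_smul_left, inner_smul_right, inner_orthonormal_sum he]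
  simp only [stereoCoord, Matrix.cons_val_zero, Matrix.cons_val_one, Matrix.cons_val, conj_trivial]
  have hX : X.re ^ 2 + X.im ^ 2 + 1 ≠ 0 := by positivity
  have hY : Y.re ^ 2 + Y.im ^ 2 + 1 ≠ 0 := by positivity
  field_simp
  ring

theorem inner_fderiv_invStereo_self (he : Orthonormal ℝ e) (X a : ℂ) :
    ⟪fderiv ℝ (invStereo q ρ e) X a, fderiv ℝ (invStereo q ρ e) X a⟫ =
    4 * ρ ^ 2 * (a.re ^ 2 + a.im ^ 2) / (X.re ^ 2 + X.im ^ 2 + 1) ^ 2 := by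
  rw [(fderiv_invStereo_apply q ρ e X a).2, inner_smul_left, inner_smul_right,
    inner_orthonormal_sum he]
  simp only [stereoCoordDeriv, Matrix.cons_val_zero, Matrix.cons_val_one, Matrix.cons_val,
    conj_trivial]
  have hX : X.re ^ 2 + X.im ^ 2 + 1 ≠ 0 := by positivity
  field_simp
  ring

theorem inner_invStereo_sub_fderiv (he : Orthonormal ℝ e) (X Y a : ℂ) :
    ⟪invStereo q ρ e X - invStereo q ρ e Y, fderiv ℝ (invStereo q ρ e) X a⟫ =
    4 * ρ ^ 2 / ((X.re ^ 2 + X.im ^ 2 + 1) * (Y.re ^ 2 + Y.im ^ 2 + 1)) *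
      (((X.re - Y.re) * a.re + (X.im - Y.im) * a.im) -
        ((X.re - Y.re) ^ 2 + (X.im - Y.im) ^ 2) * (X.re * a.re + X.im * a.im) /
          (X.re ^ 2 + X.im ^ 2 + 1)) := by
  rw [(fderiv_invStereo_apply q ρ e X a).2, invStereo_sub, inner_smul_left, inner_smul_right,
    inner_orthonormal_sum he]
  simp only [stereoCoord, stereoCoordDeriv, Matrix.cons_val_zero, Matrix.cons_val_one,
    Matrix.cons_val, conj_trivial]
  have hX : X.re ^ 2 + X.im ^ 2 + 1 ≠ 0 := by positivity
  have hY : Y.re ^ 2 + Y.im ^ 2 + 1 ≠ 0 := by positivity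
  field_simp
  ring

/-- The factors `1 + |X|²` and `1 + |Y|²` in the squared chord length each depend on one point only
and leave no trace in the mixed derivative of its logarithm. -/
theorem chordForm_invStereo (he : Orthonormal ℝ e) (hρ : 0 < ρ) {X Y : ℂ} (hXY : X ≠ Y)
    (a b : ℂ) :
    chordForm (invStereo q ρ e X - invStereo q ρ e Y) (fderiv ℝ (invStereo q ρ e) X a)
      (fderiv ℝ (invStereo q ρ e) Y b) = -2 * (a * b / (X - Y) ^ 2).re := by
  have h1 : ⟪invStereo q ρ e X - invStereo q ρ e Y, fderiv ℝ (invStereo q ρ e) Y b⟫ =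
      -⟪invStereo q ρ e Y - invStereo q ρ e X, fderiv ℝ (invStereo q ρ e) Y b⟫ := by
    rw [← inner_neg_left, neg_sub]
  rw [chordForm, h1, inner_invStereo_sub_fderiv he, inner_invStereo_sub_fderiv he,
    inner_invStereo_sub_self he, (fderiv_invStereo_apply q ρ e X a).2,
    (fderiv_invStereo_apply q ρ e Y b).2, inner_smul_left, inner_smul_right,
    inner_orthonormal_sum he]
  simp only [stereoCoordDeriv, Matrix.cons_val_zero, Matrix.cons_val_one,
    Matrix.cons_val, conj_trivial]
  have hX : X.re ^ 2 + X.im ^ 2 + 1 ≠ 0 := by positivity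
  have hY : Y.re ^ 2 + Y.im ^ 2 + 1 ≠ 0 := by positivity
  have hD : (X.re - Y.re) ^ 2 + (X.im - Y.im) ^ 2 ≠ 0 := by
    intro h
    refine hXY (Complex.ext ?_ ?_) <;> nlinarith [sq_nonneg (X.re - Y.re), sq_nonneg (X.im - Y.im)]
  have hre : (a * b / (X - Y) ^ 2).re =
      ((a.re * b.re - a.im * b.im) * ((X.re - Y.re) ^ 2 - (X.im - Y.im) ^ 2) +
        (a.re * b.im + a.im * b.re) * (2 * (X.re - Y.re) * (X.im - Y.im))) /
        ((X.re - Y.re) ^ 2 + (X.im - Y.im) ^ 2) ^ 2 := by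
    have h : Complex.normSq ((X - Y) ^ 2) = ((X.re - Y.re) ^ 2 + (X.im - Y.im) ^ 2) ^ 2 := by
      rw [map_pow, Complex.normSq_apply]; simp; ring
    rw [Complex.div_re, h]
    simp [pow_two]
    field_simp
    ring
  rw [hre]
  have hYX : (Y.re - X.re) ^ 2 + (Y.im - X.im) ^ 2 = (X.re - Y.re) ^ 2 + (X.im - Y.im) ^ 2 := by ring
  rw [hYX]
  -- Treating `|X - Y|²` as an atom lets `field_simp` clear it as a single nonzero denominator; it
  -- is expanded again for `ring`.
  generalize hDD : (X.re - Y.re) ^ 2 + (X.im - Y.im) ^ 2 = D at *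
  field_simp
  subst hDD
  ring

end Frame

/-! ### Pull-backs along `f × f`, and the real part of the complex cross ratio form. -/

theorem pullback_prodMap_omegaSphere_apply {n : ℕ} {E : Type*} [NormedAddCommGroup E]
    [NormedSpace ℝ E] {f : E → Sph n} {p : E × E} (hf : MDifferentiable 𝓘(ℝ, E) (𝓡 n) f)
    (hp : f p.1 ≠ f p.2) (w : Fin 2 → E × E) :
    pullback 𝓘(ℝ, E × E) (pairModel n) (Prod.map f f) (omegaSphere n) p w =
      mixedForm (f p.1 : Euc (n + 1)) (f p.2)
        (fderiv ℝ (fun z => (f z : Euc (n + 1))) p.1 (w 0).1)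
        (fderiv ℝ (fun z => (f z : Euc (n + 1))) p.2 (w 1).2) -
      mixedForm (f p.1 : Euc (n + 1)) (f p.2)
        (fderiv ℝ (fun z => (f z : Euc (n + 1))) p.1 (w 1).1)
        (fderiv ℝ (fun z => (f z : Euc (n + 1))) p.2 (w 0).2) := by
  have h1 := (hf p.1).hasMFDerivAt.comp p (hasFDerivAt_fst (𝕜 := ℝ) (p := p)).hasMFDerivAt
  have h2 := (hf p.2).hasMFDerivAt.comp p (hasFDerivAt_snd (𝕜 := ℝ) (p := p)).hasMFDerivAt
  have h := HasMFDerivAt.prodMk h1 h2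
  refine (pullback_omegaSphere_apply (F := Prod.map f f) h hp w).trans ?_
  simp_rw [← mfderiv_eq_fderiv]
  exact congrArg₂ (· - ·)
    (congrArg₂ (mixedForm _ _) (dincl_mfderiv (hf p.1) (w 0).1) (dincl_mfderiv (hf p.2) (w 1).2))
    (congrArg₂ (mixedForm _ _) (dincl_mfderiv (hf p.1) (w 1).1) (dincl_mfderiv (hf p.2) (w 0).2))

theorem mdifferentiable_sph_of_coe {n : ℕ} {E : Type*} [NormedAddCommGroup E]
    [NormedSpace ℝ E] {f : E → Sph n} (hf : ContDiff ℝ 1 (fun z => (f z : Euc (n + 1)))) :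
    MDifferentiable 𝓘(ℝ, E) (𝓡 n) f :=
  (contMDiff_sph_of_coe hf.contMDiff).mdifferentiable one_ne_zero

theorem inner_fderiv_sph {n : ℕ} {E : Type*} [NormedAddCommGroup E] [NormedSpace ℝ E]
    {f : E → Euc n} {x : E} (hf : DifferentiableAt ℝ f x) (h : ∀ z, f z ∈ sphere (0 : Euc n) 1)
    (a : E) : ⟪f x, fderiv ℝ f x a⟫ = 0 := by
  have h1 := (hf.hasFDerivAt.inner ℝ hf.hasFDerivAt)
  have h2 : (fun z => ⟪f z, f z⟫) = fun _ => (1 : ℝ) := by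
    funext z
    rw [real_inner_self_eq_norm_sq, mem_sphere_zero_iff_norm.1 (h z), one_pow]
  rw [h2] at h1
  have h3 := DFunLike.congr_fun (h1.unique (hasFDerivAt_const (1 : ℝ) x)) a
  simp [real_inner_comm (f x)] at h3
  linarith

theorem contDiff_invStereo {m : ℕ} (q : Euc m) (ρ : ℝ) (e : Fin 3 → Euc m) :
    ContDiff ℝ ∞ (invStereo q ρ e) := by
  unfold invStereo
  have h : ContDiff ℝ ∞ (fun ζ : ℂ => ‖ζ‖ ^ 2) := contDiff_norm_sq ℝ
  have hre : ContDiff ℝ ∞ (fun ζ : ℂ => ζ.re) := Complex.reCLM.contDiff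
  have him : ContDiff ℝ ∞ (fun ζ : ℂ => ζ.im) := Complex.imCLM.contDiff
  refine contDiff_const.add (ContDiff.smul (contDiff_const.div (h.add contDiff_const)
    fun ζ => by positivity) ?_)
  exact (((contDiff_const.mul hre).smul contDiff_const).add
    ((contDiff_const.mul him).smul contDiff_const)).add ((h.sub contDiff_const).smul contDiff_const)

theorem invStereo_injective {m : ℕ} {q : Euc m} {ρ : ℝ} {e : Fin 3 → Euc m}
    (he : Orthonormal ℝ e) (hρ : 0 < ρ) : Function.Injective (invStereo q ρ e) := by
  intro X Y h
  have h1 := inner_invStereo_sub_self (q := q) (ρ := ρ) he X Y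
  rw [h, sub_self, inner_zero_left, eq_comm, div_eq_zero_iff] at h1
  have hX : X.re ^ 2 + X.im ^ 2 + 1 ≠ 0 := by positivity
  have hY : Y.re ^ 2 + Y.im ^ 2 + 1 ≠ 0 := by positivity
  have h2 : (X.re - Y.re) ^ 2 + (X.im - Y.im) ^ 2 = 0 := by
    rcases h1 with h1 | h1
    · exact (mul_eq_zero.1 h1).resolve_left (by positivity)
    · exact absurd h1 (mul_ne_zero hX hY)
  refine Complex.ext ?_ ?_ <;> nlinarith [sq_nonneg (X.re - Y.re), sq_nonneg (X.im - Y.im)]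

theorem mixedForm_invStereo {m : ℕ} {q : Euc m} {ρ : ℝ} {e : Fin 3 → Euc m}
    (he : Orthonormal ℝ e) (hρ : 0 < ρ) (hs : ∀ ζ, invStereo q ρ e ζ ∈ sphere (0 : Euc m) 1)
    {X Y : ℂ} (hXY : X ≠ Y) (a b : ℂ) :
    mixedForm (invStereo q ρ e X) (invStereo q ρ e Y) (fderiv ℝ (invStereo q ρ e) X a)
      (fderiv ℝ (invStereo q ρ e) Y b) = -2 * (a * b / (X - Y) ^ 2).re := by
  have h1 (ζ) := mem_sphere_zero_iff_norm.1 (hs ζ)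
  have h2 (ζ) : ⟪invStereo q ρ e ζ, invStereo q ρ e ζ⟫ = 1 := by
    rw [real_inner_self_eq_norm_sq, h1, one_pow]
  have h3 (ζ a) : ⟪invStereo q ρ e ζ, fderiv ℝ (invStereo q ρ e) ζ a⟫ = 0 :=
    inner_fderiv_sph (fderiv_invStereo_apply q ρ e ζ 0).1 hs a
  have h4 := (inner_lt_one_iff_real_of_norm_eq_one (h1 X) (h1 Y)).2
    ((invStereo_injective he hρ).ne hXY)
  rw [← chordForm_invStereo he hρ hXY]
  exact mixedForm_eq_chordForm (h2 X) (h2 Y) (h3 X a) (h3 Y b) (by linarith)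

theorem rePart_crossRatioForm_apply (p : ℂ × ℂ) (w : Fin 2 → ℂ × ℂ) :
    rePart (crossRatioForm p) w = ((w 0).1 * (w 1).2 / (p.1 - p.2) ^ 2).re -
      ((w 1).1 * (w 0).2 / (p.1 - p.2) ^ 2).re := by
  have : rePart (crossRatioForm p) w =
    (1 / (p.1 - p.2) ^ 2 * ((w 0).1 * (w 1).2 - (w 1).1 * (w 0).2)).re := rfl
  rw [this, ← Complex.sub_re]
  congr 1
  ring

theorem rePart_crossRatioForm {σ : ℂ → Sph 2} (hσ : IsInvStereo σ) {p : ℂ × ℂ}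
    (hp : p ∈ distinctPairs ℂ) :
    rePart (crossRatioForm p) =
      (-(1 / 2) : ℝ) • pullback 𝓘(ℝ, ℂ × ℂ) (pairModel 2) (Prod.map σ σ) (omegaSphere 2) p := by
  obtain ⟨e, he, hσe⟩ := hσ
  have hfun : (fun ζ => (σ ζ : Euc 3)) = invStereo 0 1 e := funext hσe
  have hs (ζ) : invStereo 0 1 e ζ ∈ sphere (0 : Euc 3) 1 := hσe ζ ▸ (σ ζ).2
  have hd : MDifferentiable 𝓘(ℝ, ℂ) (𝓡 2) σ :=
    mdifferentiable_sph_of_coe (hfun ▸ (contDiff_invStereo 0 1 e).of_le (by simp))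
  have hne : σ p.1 ≠ σ p.2 := fun h => hp (invStereo_injective he one_pos
    (by rw [← hσe, ← hσe, h]))
  ext w
  have := pullback_prodMap_omegaSphere_apply hd hne w
  refine Eq.trans ?_ (congrArg (fun t : ℝ => (-(1 / 2) : ℝ) • t) this).symm
  rw [hfun, hσe, hσe]
  rw [mixedForm_invStereo he one_pos hs hp, mixedForm_invStereo he one_pos hs hp,
    rePart_crossRatioForm_apply, smul_eq_mul]
  ring

/-! ### Existence and uniqueness of the infinitesimal cross ratio. -/

theorem exists_unit_orthogonal (a b c : Euc 4) :
    ∃ N : Euc 4, ⟪N, N⟫ = 1 ∧ ⟪a, N⟫ = 0 ∧ ⟪b, N⟫ = 0 ∧ ⟪c, N⟫ = 0 := by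
  set K := Submodule.span ℝ (Set.range ![a, b, c]) with hK
  have h1 : Module.finrank ℝ K ≤ 3 := finrank_range_le_card (R := ℝ) ![a, b, c]
  have h2 : 0 < Module.finrank ℝ Kᗮ := by
    have h := K.finrank_add_finrank_orthogonal
    rw [finrank_euclideanSpace_fin] at h
    omega
  obtain ⟨z, hz⟩ := Module.finrank_pos_iff_exists_ne_zero.1 h2
  have hz0 : ‖(z : Euc 4)‖ ≠ 0 := by simpa using hz
  have hmem (i) : ⟪![a, b, c] i, (z : Euc 4)⟫ = 0 :=
    (Submodule.mem_orthogonal K z).1 z.2 _ (Submodule.subset_span ⟨i, rfl⟩)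
  refine ⟨‖(z : Euc 4)‖⁻¹ • (z : Euc 4), ?_, ?_, ?_, ?_⟩
  · rw [inner_smul_left, inner_smul_right, real_inner_self_eq_norm_sq, conj_trivial]
    field_simp
  · rw [inner_smul_right, show ⟪a, (z : Euc 4)⟫ = 0 from hmem 0, mul_zero]
  · rw [inner_smul_right, show ⟪b, (z : Euc 4)⟫ = 0 from hmem 1, mul_zero]
  · rw [inner_smul_right, show ⟪c, (z : Euc 4)⟫ = 0 from hmem 2, mul_zero]

theorem eq_sum_of_orthonormal {N : Euc 4} {e : Fin 3 → Euc 4} (he : Orthonormal ℝ e)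
    (hN : ⟪N, N⟫ = 1) (hNe : ∀ i, ⟪N, e i⟫ = 0) {z : Euc 4} (hz : ⟪N, z⟫ = 0) :
    z = ∑ i, ⟪e i, z⟫ • e i := by
  have ho : Orthonormal ℝ (Fin.cons N e : Fin 4 → Euc 4) := by
    rw [orthonormal_iff_ite] at he ⊢
    intro i j
    refine Fin.cases ?_ (fun i => ?_) i <;> refine Fin.cases ?_ (fun j => ?_) j
    · simpa using hN
    · simpa [(Fin.succ_ne_zero j).symm] using hNe j
    · simpa [real_inner_comm] using hNe i
    · simpa using he i j
  have hr : Orthonormal ℝ ((univ : Set (Fin 4)).domRestrict (Fin.cons N e : Fin 4 → Euc 4)) :=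
    ho.comp (fun i : ↥(univ : Set (Fin 4)) => i.1) Subtype.val_injective
  obtain ⟨b, hb⟩ := hr.exists_orthonormalBasis_extension_of_card_eq (by simp)
  have hb' : (b : Fin 4 → Euc 4) = Fin.cons N e := funext fun i => hb i (mem_univ i)
  have h := b.sum_repr' z
  rw [hb', Fin.sum_univ_succ] at h
  simpa [hz] using h.symm

/-- For `|ζ| = 1` the image lies on the equator. The derivative then sends the radial part of `a` to
the direction `e 2` and the part tangent to the circle to the equator, both scaled by `ρ`; the
witness inverts this. -/
theorem exists_fderiv_invStereo_eq {m : ℕ} {q : Euc m} {ρ : ℝ} {e : Fin 3 → Euc m} (hρ : 0 < ρ)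
    {ζ : ℂ} (hζ : ζ.re ^ 2 + ζ.im ^ 2 = 1) {α : Fin 3 → ℝ} (hα : α 0 * ζ.re + α 1 * ζ.im = 0) :
    ∃ a : ℂ, fderiv ℝ (invStereo q ρ e) ζ a = ∑ i, α i • e i := by
  refine ⟨⟨(α 0 + α 2 * ζ.re) / ρ, (α 1 + α 2 * ζ.im) / ρ⟩, ?_⟩
  rw [(fderiv_invStereo_apply q ρ e ζ _).2, Finset.smul_sum]
  have hin : ζ.re * ((α 0 + α 2 * ζ.re) / ρ) + ζ.im * ((α 1 + α 2 * ζ.im) / ρ) = α 2 / ρ := by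
    field_simp
    linear_combination hα + α 2 * hζ
  refine Finset.sum_congr rfl fun i _ => ?_
  rw [smul_smul]
  congr 1
  fin_cases i <;> simp only [stereoCoordDeriv, hin, hζ] <;> simp <;> field_simp <;> ring

theorem orthonormal_neg_one {m : ℕ} {e : Fin 3 → Euc m} (he : Orthonormal ℝ e) :
    Orthonormal ℝ ![e 0, -e 1, e 2] := by
  rw [orthonormal_iff_ite] at he ⊢
  intro i j
  have h := he i j
  fin_cases i <;> fin_cases j <;> simpa using h

/-- Reversing `e 1` conjugates the coordinate; this is the change of orientation used to make the
imaginary part non-negative. -/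
theorem invStereo_conj {m : ℕ} (q : Euc m) (ρ : ℝ) (e : Fin 3 → Euc m) (ζ : ℂ) :
    invStereo q ρ ![e 0, -e 1, e 2] (starRingEnd ℂ ζ) = invStereo q ρ e ζ := by
  rw [invStereo_eq, invStereo_eq]
  simp [Fin.sum_univ_three, stereoCoord, neg_div]

theorem fderiv_invStereo_conj {m : ℕ} (q : Euc m) (ρ : ℝ) (e : Fin 3 → Euc m) (ζ a : ℂ) :
    fderiv ℝ (invStereo q ρ ![e 0, -e 1, e 2]) (starRingEnd ℂ ζ) (starRingEnd ℂ a) =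
      fderiv ℝ (invStereo q ρ e) ζ a := by
  rw [(fderiv_invStereo_apply _ _ _ _ _).2, (fderiv_invStereo_apply _ _ _ _ _).2]
  congr 1
  simp only [Fin.sum_univ_three, stereoCoordDeriv, Complex.conj_re, Complex.conj_im,
    Matrix.cons_val_zero, Matrix.cons_val_one, Matrix.cons_val, smul_neg, ← neg_smul]
  congr 1
  · congr 1 <;> congr 1 <;> ring
  · congr 1; ring

theorem exists_infinitesimalCrossRatio {x y u v : Euc 4} (hx : ⟪x, x⟫ = 1) (hy : ⟪y, y⟫ = 1)
    (hxy : x ≠ y) (hu : ⟪x, u⟫ = 0) (hv : ⟪y, v⟫ = 0) :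
    ∃ c, IsInfinitesimalCrossRatio x y u v c := by
  -- The hyperplane through `x` with normal `N` contains `y` and both tangent directions. It cuts
  -- `S^3` in the two-sphere with centre `t • N` and squared radius `1 - t ^ 2`.
  obtain ⟨N, hN, hNd, hNu, hNv⟩ := exists_unit_orthogonal (y - x) u v
  set t := ⟪x, N⟫ with ht
  have hyN : ⟪y, N⟫ = t := by rw [inner_sub_left] at hNd; linarith
  obtain ⟨q, hq⟩ : ∃ q, q = t • N := ⟨_, rfl⟩
  have hxq : ⟪x - q, x - q⟫ = 1 - t ^ 2 := by
    simp only [hq, inner_sub_left, inner_sub_right, inner_smul_left, inner_smul_right, hx, hN,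
      real_inner_comm x N, conj_trivial, ← ht]
    ring
  have hyq : ⟪y - q, y - q⟫ = 1 - t ^ 2 := by
    simp only [hq, inner_sub_left, inner_sub_right, inner_smul_left, inner_smul_right, hy, hN,
      real_inner_comm y N, conj_trivial, hyN]
    ring
  have hpos : 0 < 1 - t ^ 2 := by
    -- Radius zero would force `x = q = y`.
    rcases (hxq ▸ real_inner_self_nonneg : 0 ≤ 1 - t ^ 2).eq_or_lt with h | h
    · rw [← h, inner_self_eq_zero, sub_eq_zero] at hxq hyq
      exact absurd (hxq.trans hyq.symm) hxy
    · exact h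
  set ρ := √(1 - t ^ 2) with hρ'
  have hρ : 0 < ρ := Real.sqrt_pos.2 hpos
  have hρ2 : ρ ^ 2 = 1 - t ^ 2 := Real.sq_sqrt hpos.le
  set e₀ := ρ⁻¹ • (x - q) with he₀
  have hxe : x - q = ρ • e₀ := (smul_inv_smul₀ hρ.ne' _).symm
  have h00 : ⟪e₀, e₀⟫ = 1 := by
    rw [he₀, inner_smul_left, inner_smul_right, hxq, ← hρ2, conj_trivial]
    field_simp
  have hN0 : ⟪N, e₀⟫ = 0 := by
    rw [he₀, inner_smul_right, inner_sub_right, hq, inner_smul_right, hN, real_inner_comm x N, ← ht]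
    ring
  -- The pole direction is orthogonal to `e₀` and `y`, so both points lie on the equator: `x` has
  -- coordinate `1` and `y` a coordinate of modulus one.
  obtain ⟨e₂, h22, hN2, h02, hy2⟩ := exists_unit_orthogonal N e₀ y
  obtain ⟨e₁, h11, hN1, h01, h21⟩ := exists_unit_orthogonal N e₀ e₂
  set e : Fin 3 → Euc 4 := ![e₀, e₁, e₂] with he'
  have he : Orthonormal ℝ e := by
    rw [orthonormal_iff_ite]
    intro i j
    fin_cases i <;> fin_cases j <;>
      simp [he', -inner_self_eq_norm_sq_to_K, h00, h11, h22, h01, h02,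
        h21, real_inner_comm e₀, real_inner_comm e₂]
  have hNe (i) : ⟪N, e i⟫ = 0 := by fin_cases i <;> simp [he', hN0, hN1, hN2]
  have hqe (i) : ⟪q, e i⟫ = 0 := by rw [hq, inner_smul_left, hNe, mul_zero]
  have hqq : ⟪q, q⟫ = t ^ 2 := by
    rw [hq, inner_smul_left, inner_smul_right, hN, conj_trivial]; ring
  have hs (ζ) : invStereo q ρ e ζ ∈ sphere (0 : Euc 4) 1 := by
    have h1 : ⟪q, ∑ i, stereoCoord ζ i • e i⟫ = 0 := by
      rw [inner_sum]
      simp [inner_smul_right, hqe]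
    have h2 : ⟪∑ i, stereoCoord ζ i • e i, ∑ i, stereoCoord ζ i • e i⟫ = 1 := by
      rw [inner_orthonormal_sum he]
      have hζ : ζ.re ^ 2 + ζ.im ^ 2 + 1 ≠ 0 := by positivity
      simp only [stereoCoord, Matrix.cons_val_zero, Matrix.cons_val_one, Matrix.cons_val]
      field_simp
      ring
    have h3 : ⟪∑ i, stereoCoord ζ i • e i, q⟫ = 0 := (real_inner_comm _ _).trans h1
    rw [mem_sphere_zero_iff_norm, norm_eq_sqrt_real_inner, invStereo_eq, Real.sqrt_eq_one,
      inner_add_left, inner_add_right, inner_add_right, real_inner_smul_left,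
      real_inner_smul_left, real_inner_smul_right, real_inner_smul_right, h1, h3,
      h2, hqq]
    linear_combination hρ2
  have hye := eq_sum_of_orthonormal he hN hNe (z := y - q)
    (by rw [hq, inner_sub_right, inner_smul_right, hN, real_inner_comm y N, hyN]; ring)
  have hye2 : ⟪e 2, y - q⟫ = 0 := by
    rw [inner_sub_right, real_inner_comm q, hqe, real_inner_comm y]
    simp [he', hy2]
  set Y : ℂ := ⟨⟪e 0, y - q⟫ / ρ, ⟪e 1, y - q⟫ / ρ⟩ with hY
  have hYY : Y.re ^ 2 + Y.im ^ 2 = 1 := by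
    have h := inner_orthonormal_sum he (fun i => ⟪e i, y - q⟫) (fun i => ⟪e i, y - q⟫)
    rw [← hye, hyq, hye2, ← hρ2] at h
    rw [hY]
    field_simp
    linarith
  have hX' : invStereo q ρ e 1 = x := by
    rw [invStereo_eq]
    refine (sub_eq_iff_eq_add'.1 ?_).symm
    rw [hxe]
    simp [stereoCoord, Fin.sum_univ_three, he']
    norm_num
  have hY' : invStereo q ρ e Y = y := by
    rw [invStereo_eq]
    refine (sub_eq_iff_eq_add'.1 ?_).symm
    conv_lhs => rw [hye]
    rw [Fin.sum_univ_three, Fin.sum_univ_three, hye2]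
    simp only [stereoCoord, hYY]
    simp only [hY, Matrix.cons_val_zero, Matrix.cons_val_one, Matrix.cons_val, smul_add, smul_smul]
    congr 1
    · congr 1 <;> congr 1 <;> field_simp <;> ring
    · simp
  have hue := eq_sum_of_orthonormal he hN hNe (z := u) (by rw [real_inner_comm]; exact hNu)
  have hve := eq_sum_of_orthonormal he hN hNe (z := v) (by rw [real_inner_comm]; exact hNv)
  obtain ⟨a, ha⟩ := exists_fderiv_invStereo_eq (q := q) (e := e) hρ (ζ := 1) (by simp)
    (α := fun i => ⟪e i, u⟫) (by
      have : ⟪x - q, u⟫ = 0 := by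
        rw [inner_sub_left, hu, hq, inner_smul_left, real_inner_comm u, hNu]; simp
      rw [hxe, inner_smul_left] at this
      simpa [he', hρ.ne'] using this)
  obtain ⟨b, hb⟩ := exists_fderiv_invStereo_eq (q := q) (e := e) hρ hYY
    (α := fun i => ⟪e i, v⟫) (by
      have h1 : ⟪y - q, v⟫ = 0 := by
        rw [inner_sub_left, hv, hq, inner_smul_left, real_inner_comm v, hNv]; simp
      have h2 := inner_orthonormal_sum he (fun i => ⟪e i, y - q⟫) (fun i => ⟪e i, v⟫)
      rw [← hye, ← hve, h1, hye2] at h2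
      simp only [hY]
      field_simp
      linarith)
  rw [← hue] at ha
  rw [← hve] at hb
  by_cases hc : 0 ≤ (a * b / (1 - Y) ^ 2).im
  · exact ⟨_, q, ρ, e, hρ, he, hs, 1, Y, a, b, hX', hY', ha, hb, rfl, hc⟩
  · refine ⟨_, q, ρ, ![e 0, -e 1, e 2], hρ, orthonormal_neg_one he, fun ζ => ?_,
      starRingEnd ℂ 1, starRingEnd ℂ Y, starRingEnd ℂ a, starRingEnd ℂ b,
      (invStereo_conj q ρ e 1).trans hX', (invStereo_conj q ρ e Y).trans hY',
      (fderiv_invStereo_conj q ρ e 1 a).trans ha, (fderiv_invStereo_conj q ρ e Y b).trans hb,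
      rfl, ?_⟩
    · have := invStereo_conj q ρ e (starRingEnd ℂ ζ)
      rw [Complex.conj_conj] at this
      exact this ▸ hs _
    · rw [← map_mul, ← map_sub, ← map_pow, ← map_div₀, Complex.conj_im]
      linarith

theorem infinitesimalCrossRatio_re {x y u v : Euc 4} {c : ℂ} (hxy : x ≠ y)
    (h : IsInfinitesimalCrossRatio x y u v c) : c.re = -(1 / 2) * mixedForm x y u v := by
  obtain ⟨q, ρ, e, hρ, he, hs, X, Y, a, b, rfl, rfl, rfl, rfl, rfl, -⟩ := h
  rw [mixedForm_invStereo he hρ hs (fun h => hxy (congrArg _ h))]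
  ring

/-- Stereographic projection is conformal, and its scale factors at `X` and `Y` cancel against those
in the chord length. -/
theorem infinitesimalCrossRatio_normSq {x y u v : Euc 4} {c : ℂ} (hxy : x ≠ y)
    (h : IsInfinitesimalCrossRatio x y u v c) :
    Complex.normSq c = ⟪u, u⟫ * ⟪v, v⟫ / ⟪x - y, x - y⟫ ^ 2 := by
  obtain ⟨q, ρ, e, hρ, he, hs, X, Y, a, b, rfl, rfl, rfl, rfl, rfl, -⟩ := h
  have hX : X.re ^ 2 + X.im ^ 2 + 1 ≠ 0 := by positivity
  have hY : Y.re ^ 2 + Y.im ^ 2 + 1 ≠ 0 := by positivity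
  rw [inner_invStereo_sub_self he, inner_fderiv_invStereo_self he, inner_fderiv_invStereo_self he,
    map_div₀, map_pow, map_mul, Complex.normSq_apply, Complex.normSq_apply, Complex.normSq_apply,
    Complex.sub_re, Complex.sub_im]
  by_cases hD : (X.re - Y.re) ^ 2 + (X.im - Y.im) ^ 2 = 0
  · simp [hD, ← pow_two]
  · have hD' : (X.re - Y.re) * (X.re - Y.re) + (X.im - Y.im) * (X.im - Y.im) ≠ 0 := by
      simpa [pow_two] using hD
    field_simp

/-- Real part and modulus depend only on `x`, `y`, `u`, `v`, which leaves only the sign of the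
imaginary part. -/
theorem infinitesimalCrossRatio_unique {x y u v : Euc 4} {c c' : ℂ} (hxy : x ≠ y)
    (h : IsInfinitesimalCrossRatio x y u v c) (h' : IsInfinitesimalCrossRatio x y u v c') :
    c = c' := by
  have h1 : c.re = c'.re := (infinitesimalCrossRatio_re hxy h).trans
    (infinitesimalCrossRatio_re hxy h').symm
  have h2 := (infinitesimalCrossRatio_normSq hxy h).trans
    (infinitesimalCrossRatio_normSq hxy h').symm
  rw [Complex.normSq_apply, Complex.normSq_apply, h1] at h2
  have h3 : 0 ≤ c.im := by obtain ⟨q, ρ, e, -, -, -, X, Y, a, b, -, -, -, -, -, h⟩ := h; exact h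
  have h4 : 0 ≤ c'.im := by obtain ⟨q, ρ, e, -, -, -, X, Y, a, b, -, -, -, -, -, h⟩ := h'; exact h
  exact Complex.ext h1 ((mul_self_inj h3 h4).1 (by linarith))

theorem existsUnique_infinitesimalCrossRatio {x y u v : Euc 4} (hx : ⟪x, x⟫ = 1)
    (hy : ⟪y, y⟫ = 1) (hxy : x ≠ y) (hu : ⟪x, u⟫ = 0) (hv : ⟪y, v⟫ = 0) :
    ∃! c, IsInfinitesimalCrossRatio x y u v c := by
  obtain ⟨c, hc⟩ := exists_infinitesimalCrossRatio hx hy hxy hu hv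
  exact ⟨c, hc, fun c' hc' => infinitesimalCrossRatio_unique hxy hc' hc⟩

/-! ### Knots, and a primitive of the real part. -/

theorem mixedForm_smul_smul {m : ℕ} (x y u v : Euc m) (a b : ℝ) :
    mixedForm x y (a • u) (b • v) = a * b * mixedForm x y u v := by
  simp only [mixedForm, real_inner_smul_left, real_inner_smul_right]
  ring

section Knot

variable {r : ℕ∞} {γ : ℝ → Sph 3}

theorem existsUnique_knotCrossRatio (hγ : ContDiff ℝ 1 (fun t => (γ t : Euc 4))) {p : ℝ × ℝ}
    (hp : p ∈ knotPairs γ) : ∃! c : ℂ, IsKnotCrossRatio γ p c := by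
  have h (t : ℝ) : ⟪(γ t : Euc 4), deriv (fun s => (γ s : Euc 4)) t⟫ = 0 :=
    inner_fderiv_sph (hγ.differentiable one_ne_zero t) (fun z => (γ z).2) 1
  exact existsUnique_infinitesimalCrossRatio (inner_self_sph _) (inner_self_sph _)
    (fun h => hp (Subtype.ext h)) (h _) (h _)

/-- The function `⟨γ(t), γ'(s)⟩ / (2 (1 - ⟨γ(s), γ(t)⟩))`. -/
noncomputable def knotPotential (g : ℝ → Euc 4) (p : ℝ × ℝ) : ℝ :=
  1 / 2 * (⟪g p.2, deriv g p.1⟫ * (1 - ⟪g p.1, g p.2⟫)⁻¹)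

theorem rePart_knotCrossRatio_apply (hγ : ContDiff ℝ 1 (fun t => (γ t : Euc 4))) {p : ℝ × ℝ}
    (hp : p ∈ knotPairs γ) (w : Fin 2 → ℝ × ℝ) :
    rePart (knotCrossRatio γ p) w = -(1 / 2) * mixedForm (γ p.1 : Euc 4) (γ p.2)
      (deriv (fun s => (γ s : Euc 4)) p.1) (deriv (fun s => (γ s : Euc 4)) p.2) *
      ((w 0).1 * (w 1).2 - (w 1).1 * (w 0).2) := by
  -- Existence ensures that the chosen coefficient really is a cross ratio.
  have h := Classical.epsilon_spec (existsUnique_knotCrossRatio hγ hp).exists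
  rw [← infinitesimalCrossRatio_re (fun h => hp (Subtype.ext h)) h]
  have : rePart (knotCrossRatio γ p) w = (Classical.epsilon (IsKnotCrossRatio γ p) *
    (((w 0).1 : ℂ) * ((w 1).2 : ℂ) - ((w 1).1 : ℂ) * ((w 0).2 : ℂ))).re := rfl
  rw [this]
  simp

theorem rePart_knotCrossRatio_eq_pullback (hγ : ContDiff ℝ 1 (fun t => (γ t : Euc 4)))
    {p : ℝ × ℝ} (hp : p ∈ knotPairs γ) :
    rePart (knotCrossRatio γ p) = (-(1 / 2) : ℝ) •
      pullback 𝓘(ℝ, ℝ × ℝ) (pairModel 3) (Prod.map γ γ) (omegaSphere 3) p := by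
  ext w
  have := pullback_prodMap_omegaSphere_apply (mdifferentiable_sph_of_coe hγ) hp w
  refine Eq.trans ?_ (congrArg (fun t : ℝ => (-(1 / 2) : ℝ) • t) this).symm
  have hd (t a : ℝ) : fderiv ℝ (fun s => (γ s : Euc 4)) t a =
      a • deriv (fun s => (γ s : Euc 4)) t := fderiv_eq_smul_deriv _
  rw [hd, hd, hd, hd, mixedForm_smul_smul, mixedForm_smul_smul, rePart_knotCrossRatio_apply hγ hp,
    smul_eq_mul]
  ring

theorem contDiffAt_knotPotential {g : ℝ → Euc 4} (hg : ContDiff ℝ (r + 1 : ℕ∞) g) {p : ℝ × ℝ}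
    (hp : 1 - ⟪g p.1, g p.2⟫ ≠ 0) : ContDiffAt ℝ r (knotPotential g) p := by
  have h0 : ContDiff ℝ r g := hg.of_le (by simp)
  have h1 : ContDiff ℝ r (deriv g) := ((contDiff_succ_iff_deriv (n := (r : ℕ∞ω))).1
    (by simpa using hg)).2.2
  unfold knotPotential
  exact contDiffAt_const.mul ((((h0.comp contDiff_snd).inner ℝ (h1.comp contDiff_fst)).contDiffAt).mul
    ((contDiff_const.sub ((h0.comp contDiff_fst).inner ℝ (h0.comp contDiff_snd))).contDiffAt.inv hp))

/-- The potential is `-½ ∂_s log (1 - ⟨g(s), g(t)⟩)`, so its `t`-derivative is half the mixed form.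
No second derivative of `g` enters. -/
theorem deriv_snd_knotPotential {g : ℝ → Euc 4} (hg : Differentiable ℝ g) {p : ℝ × ℝ}
    (hp : 1 - ⟪g p.1, g p.2⟫ ≠ 0) (hd : DifferentiableAt ℝ (knotPotential g) p) :
    fderiv ℝ (knotPotential g) p (0, 1) =
      1 / 2 * mixedForm (g p.1) (g p.2) (deriv g p.1) (deriv g p.2) := by
  have h1 := hd.hasFDerivAt.comp_hasDerivAt p.2
    ((hasDerivAt_const p.2 p.1).prodMk (hasDerivAt_id p.2))
  have h2 := (hg p.2).hasDerivAt
  have h3 := (((h2.inner ℝ (hasDerivAt_const p.2 (deriv g p.1))).mul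
    (((hasDerivAt_const p.2 (g p.1)).inner ℝ h2).const_sub 1 |>.fun_inv hp)).const_mul (1 / 2 : ℝ))
  have h4 := h1.unique h3
  rw [h4]
  simp only [mixedForm, inner_zero_left, inner_zero_right, add_zero, zero_add,
    real_inner_comm (deriv g p.1) (deriv g p.2), real_inner_comm (deriv g p.1) (g p.2)]
  field_simp

/-- The one-form `⟨γ(t), γ'(s)⟩ / (2 (1 - ⟨γ(s), γ(t)⟩)) ds`. -/
noncomputable def knotPrimitive (g : ℝ → Euc 4) (p : ℝ × ℝ) : (ℝ × ℝ) [⋀^Fin 1]→L[ℝ] ℝ :=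
  knotPotential g p • ContinuousAlternatingMap.ofSubsingleton ℝ (ℝ × ℝ) ℝ (0 : Fin 1)
    (ContinuousLinearMap.fst ℝ ℝ ℝ)

theorem extDeriv_knotPrimitive {g : ℝ → Euc 4} (hg : Differentiable ℝ g) {p : ℝ × ℝ}
    (hp : 1 - ⟪g p.1, g p.2⟫ ≠ 0) (hd : DifferentiableAt ℝ (knotPotential g) p)
    (w : Fin 2 → ℝ × ℝ) :
    extDeriv (knotPrimitive g) p w = -(1 / 2) *
      mixedForm (g p.1) (g p.2) (deriv g p.1) (deriv g p.2) *
      ((w 0).1 * (w 1).2 - (w 1).1 * (w 0).2) := by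
  have h1 : DifferentiableAt ℝ (knotPrimitive g) p := hd.smul_const _
  have h2 (z : ℝ × ℝ) (v : Fin 1 → ℝ × ℝ) :
      fderiv ℝ (fun p => knotPrimitive g p v) p z = fderiv ℝ (knotPotential g) p z * (v 0).1 := by
    have : (fun p => knotPrimitive g p v) = fun p => knotPotential g p * (v 0).1 := rfl
    rw [this, fderiv_mul_const hd]
    simp [mul_comm]
  have h3 (z : ℝ × ℝ) : fderiv ℝ (knotPotential g) p z =
      z.1 * fderiv ℝ (knotPotential g) p (1, 0) + z.2 * fderiv ℝ (knotPotential g) p (0, 1) := by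
    rw [← smul_eq_mul, ← smul_eq_mul, ← map_smul, ← map_smul, ← map_add]
    simp
  -- In `d(f ds) = -∂_t f ds ∧ dt` the `s`-derivative of `f` cancels, so only `∂_t f` has to be
  -- computed.
  rw [extDeriv_apply h1, Fin.sum_univ_two, h2, h2, h3, h3 (w 1), deriv_snd_knotPotential hg hp hd]
  simp [Fin.removeNth]
  ring

/-- Invariance under integer translations is what makes the primitive descend from the parameter
plane to `K × K`. -/
theorem knotPrimitive_periodic {g : ℝ → Euc 4} (hg : ∀ (t : ℝ) (m : ℤ), g (t + m) = g t)
    (p : ℝ × ℝ) (k l : ℤ) : knotPrimitive g (p.1 + k, p.2 + l) = knotPrimitive g p := by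
  have h (t : ℝ) (m : ℤ) : deriv g (t + m) = deriv g t := by
    rw [← deriv_comp_add_const]
    simp_rw [hg]
  simp only [knotPrimitive, knotPotential, hg, h]

theorem exists_primitive_rePart_knotCrossRatio (hr : 1 ≤ r) (hγ : IsKnot (r + 1 : ℕ∞) γ) :
    ∃ η : ℝ × ℝ → (ℝ × ℝ) [⋀^Fin 1]→L[ℝ] ℝ,
      ContDiffOn ℝ r η (knotPairs γ) ∧
      (∀ (p : ℝ × ℝ) (k l : ℤ), η (p.1 + k, p.2 + l) = η p) ∧
      ∀ p ∈ knotPairs γ, extDeriv η p = rePart (knotCrossRatio γ p) := by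
  have hr' : (1 : ℕ∞ω) ≤ r := by exact_mod_cast hr
  have h1 : ContDiff ℝ 1 (fun t => (γ t : Euc 4)) :=
    hγ.contDiff.of_le (hr'.trans (by simp))
  have hne {p : ℝ × ℝ} (hp : p ∈ knotPairs γ) := (one_sub_inner_pos hp).ne'
  have hc {p : ℝ × ℝ} (hp : p ∈ knotPairs γ) :=
    contDiffAt_knotPotential (r := r) hγ.contDiff (hne hp)
  refine ⟨knotPrimitive fun t => (γ t : Euc 4), fun p hp => ?_, fun p k l => ?_, fun p hp => ?_⟩
  · exact ((hc hp).smul contDiffAt_const).contDiffWithinAt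
  · exact knotPrimitive_periodic
      (fun t m => congrArg Subtype.val ((hγ.eq_iff t (t + m)).2 ⟨m, rfl⟩).symm) p k l
  · ext w
    rw [extDeriv_knotPrimitive (h1.differentiable one_ne_zero) (hne hp)
      ((hc hp).differentiableAt (by positivity)), rePart_knotCrossRatio_apply h1 hp]

end Knot

theorem mainTheorem2 :
    -- `φ` is a smooth bijection from `S^n × S^n ∖ Δ` onto `T^* S^n`, and `ω_{S^n}` is invariant
    (∀ n : ℕ,
      BijOn (toCotangent n) (distinctPairs (Sph n)) univ ∧
      ContMDiffOn (pairModel n) (cotangentModel n) ∞ (toCotangent n) (distinctPairs (Sph n)) ∧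
      ∀ T : Sph n → Sph n, IsMoebius T →
        ContMDiff (𝓡 n) (𝓡 n) ∞ T ∧ MapsTo (Prod.map T T) (distinctPairs (Sph n)) (distinctPairs (Sph n)) ∧
        ∀ p ∈ distinctPairs (Sph n),
          pullback (pairModel n) (pairModel n) (Prod.map T T) (omegaSphere n) p
            = omegaSphere n p) ∧
    -- `Re ω_cr = -½ ω_{S^2}`
    (∀ σ : ℂ → Sph 2, IsInvStereo σ → ∀ p ∈ distinctPairs ℂ,
      rePart (crossRatioForm p)
        = (-(1 / 2) : ℝ) • pullback 𝓘(ℝ, ℂ × ℂ) (pairModel 2) (Prod.map σ σ) (omegaSphere 2) p) ∧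
    -- `Re Ω_K = -½ ι^* ω_{S^3}`, and `Re Ω_K` is exact
    (∀ (r : ℕ∞) (γ : ℝ → Sph 3), 1 ≤ r → IsKnot (r + 1 : ℕ∞) γ →
      (∀ p ∈ knotPairs γ, ∃! c : ℂ, IsKnotCrossRatio γ p c) ∧
      (∀ p ∈ knotPairs γ,
        rePart (knotCrossRatio γ p)
          = (-(1 / 2) : ℝ) •
            pullback 𝓘(ℝ, ℝ × ℝ) (pairModel 3) (Prod.map γ γ) (omegaSphere 3) p) ∧
      ∃ η : ℝ × ℝ → (ℝ × ℝ) [⋀^Fin 1]→L[ℝ] ℝ,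
        ContDiffOn ℝ r η (knotPairs γ) ∧
        (∀ (p : ℝ × ℝ) (k l : ℤ), η (p.1 + k, p.2 + l) = η p) ∧
        ∀ p ∈ knotPairs γ, extDeriv η p = rePart (knotCrossRatio γ p)) := by
  refine ⟨fun n => ⟨bijOn_toCotangent n,
    fun p hp => (contMDiffAt_toCotangent hp).contMDiffWithinAt, fun T hT => ?_⟩,
    fun σ hσ p hp => rePart_crossRatioForm hσ hp, fun r γ hr hγ => ?_⟩
  · obtain ⟨M, hML, hM⟩ := isMoebius_exists_linearMap hT
    exact ⟨contMDiff_moebius hM, fun p hp => moebius_ne hML hM hp,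
      fun p hp => pullback_moebius hML hM hp⟩
  · have h1 : ContDiff ℝ 1 (fun t => (γ t : Euc 4)) :=
      hγ.contDiff.of_le (by exact_mod_cast hr.trans le_self_add)
    exact ⟨fun p hp => existsUnique_knotCrossRatio h1 hp,
      fun p hp => rePart_knotCrossRatio_eq_pullback h1 hp,
      exists_primitive_rePart_knotCrossRatio hr hγ⟩
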